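/- Let $\alpha>0$ and consider the damped pendulum with oscillating support $\theta''+(\alpha-\varepsilon\cos(\tau-\tau_0))\sin\theta+C_1\varepsilon\,\theta'=0$, with $C_1,\tau_0\in\mathbb R$. For $k\in(0,1)$ let $\mathbf K(k),\mathbf E(k)$ be the complete elliptic integrals of the first and second kind, $\mathrm{sn},\mathrm{cn},\mathrm{dn}$ the Jacobi elliptic functions of modulus $k$, and $\mathbf Z(u,k)=\int_0^u\mathrm{dn}^2(v,k)\,dv-\frac{\mathbf E(k)}{\mathbf K(k)}u$ the Jacobi zeta function. In the action-angle variables $(\varphi,I)$ of the rotations of $\theta''+\alpha\sin\theta=0$, where $I=\frac{4}{k\pi}\sqrt\alpha\,\mathbf E(k)$ defines $k=k(I)\in(0,1)$, the system reads $$\varphi'=\Omega(I)+\varepsilon f_1(\varphi,I,\tau),\qquad I'=\varepsilon f_2(\varphi,I,\tau),\qquad \Omega(I)=\frac{\pi\sqrt\alpha}{k\mathbf K(k)},$$ $$f_1=\frac{\pi k}{\sqrt\alpha\,\mathbf K(k)}\Bigl[\frac{k^2\mathrm{sn}^2\mathrm{cn}^2}{1-k^2}-\frac{\mathbf Z\,\mathrm{sn}\,\mathrm{cn}\,\mathrm{dn}}{1-k^2}\Bigr]\cos(\tau-\tau_0)-\frac{C_1\pi}{\mathbf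 K(k)}\Bigl[\frac{k^2\mathrm{sn}\,\mathrm{cn}\,\mathrm{dn}}{1-k^2}-\frac{\mathbf Z\,\mathrm{dn}^2}{1-k^2}\Bigr],$$ $$f_2=\frac{4\mathbf K(k)}{\pi}\cos(\tau-\tau_0)\,\mathrm{sn}\,\mathrm{cn}\,\mathrm{dn}-\frac{4C_1\sqrt\alpha\,\mathbf K(k)}{\pi k}\mathrm{dn}^2,$$ all elliptic functions being evaluated at $(\mathbf K(k)\varphi/\pi,k)$. Fix $k_2\in(0,1)$ and coprime positive integers $\mathfrak p,\mathfrak q$ satisfying the resonance condition $T:=2\pi\mathfrak q=4k_2\mathbf K(k_2)\mathfrak p/\sqrt\alpha$. Consider the formal series $\varphi=\sum_{n\ge0}\varepsilon^n\varphi^{(n)}$, $I=\sum_{n\ge0}\varepsilon^nI^{(n)}$, where $\varphi^{(0)}(\tau)=\frac{\pi\sqrt\alpha}{k_2\mathbf K(k_2)}\tau$, $I^{(0)}=\frac{4}{k_2\pi}\sqrt\alpha\,\mathbf E(k_2)$ and, for $n\ge1$, $$(\varphi^{(n)})'=\zeta^{(0)}I^{(n)}+F_1^{(n)},\quad (I^{(n)})'=F_2^{(n)},\quad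 \varphi^{(n)}(0)=\bar\varphi^{(n)},\quad I^{(n)}(0)=\bar I^{(n)},$$ with $\zeta^{(0)}=\Omega'(I^{(0)})$, $F_1^{(n)}=[\Omega(I)-\zeta^{(0)}I]^{(n)}+[f_1(\varphi,I,\tau)]^{(n-1)}$, $F_2^{(n)}=[f_2(\varphi,I,\tau)]^{(n-1)}$, where $[\cdot]^{(n)}$ is the coefficient of $\varepsilon^n$ after insertion of the series. Write $\langle g\rangle=\frac1T\int_0^Tg\,d\tau$ and $$\Delta=\frac{\sqrt\alpha}{2k_2\mathbf K(k_2)}\int_0^{2k_2\mathbf K(k_2)/\sqrt\alpha}\mathrm{dn}^2\Bigl(\tfrac{\sqrt\alpha}{k_2}\tau,k_2\Bigr)d\tau,\qquad G_1=\frac1T\int_0^T(\mathrm{sn}\,\mathrm{cn}\,\mathrm{dn})\Bigl(\tfrac{\sqrt\alpha}{k_2}\tau,k_2\Bigr)\sin\tau\,d\tau .$$ Then: (i) $\langle F_2^{(1)}\rangle=0$ if and only if $C_1=\frac{k_2\sin\tau_0}{\sqrt\alpha\,\Delta}G_1$, whatever the initial conditions. (ii) If $\mathfrak p/\mathfrak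 q=1/2m$ for some integer $m\ge1$, then $\frac{k_2}{\sqrt\alpha\,\Delta}G_1>0$. Moreover, whenever $|C_1|<\frac{k_2}{\sqrt\alpha\,\Delta}G_1$, there is a $\tau_0$ with $C_1=\frac{k_2\sin\tau_0}{\sqrt\alpha\,\Delta}G_1$, and for every such $\tau_0$ one can choose the initial conditions $(\bar\varphi^{(n)},\bar I^{(n)})_{n\ge1}$ so that, for all $n\ge1$, $\varphi^{(n)}$, $I^{(n)}$ and $F_2^{(n)}$ are $T$-periodic, $F_2^{(n)}$ is continuous, and $\langle F_2^{(n)}\rangle=0$. (iii) If $\mathfrak p/\mathfrak q\ne1/2m$ for all integers $m\ge1$, then, for all $\tau_0$ and all initial conditions, $\langle F_2^{(1)}\rangle=0$ (a fortiori $\langle F_2^{(n)}\rangle=0$ for all $n\ge1$) only if $C_1=0$. -/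

import Mathlib

open Real Set

namespace Pendulum

noncomputable section

/-! ### Elliptic integrals and Jacobi elliptic functions (with modulus `k`) -/

/-- Incomplete elliptic integral of the first kind, as a function of the amplitude `x`. -/
def ellF (k x : ℝ) : ℝ := ∫ ψ in (0 : ℝ)..x, 1 / √(1 - k ^ 2 * sin ψ ^ 2)

/-- Complete elliptic integral of the first kind `K(k)`. -/
def ellK (k : ℝ) : ℝ := ∫ ψ in (0 : ℝ)..(π / 2), 1 / √(1 - k ^ 2 * sin ψ ^ 2)

/-- Complete elliptic integral of the second kind `E(k)`. -/
def ellE (k : ℝ) : ℝ := ∫ ψ in (0 : ℝ)..(π / 2), √(1 - k ^ 2 * sin ψ ^ 2)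

/-- Jacobi amplitude `am(u, k)`: the inverse function of `x ↦ ellF k x`, which for
`|k| < 1` is a bijection of the real line. -/
def am (u k : ℝ) : ℝ := Function.invFun (ellF k) u

def sn (u k : ℝ) : ℝ := sin (am u k)

def cn (u k : ℝ) : ℝ := cos (am u k)

def dn (u k : ℝ) : ℝ := √(1 - k ^ 2 * sn u k ^ 2)

/-- Elliptic integral of the second kind `E(u, k)`, the primitive of `dn²(·, k)`. -/
def ellEinc (u k : ℝ) : ℝ := ∫ v in (0 : ℝ)..u, dn v k ^ 2

/-- Jacobi zeta function `Z(u, k) = E(u, k) - E(k) u / K(k)`. -/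
def ellZ (u k : ℝ) : ℝ := ellEinc u k - ellE k / ellK k * u

/-! ### Action-angle variables of the rotations of `θ'' + α sin θ = 0` -/

/-- The action of the rotation with modulus `k`. -/
def rotAction (α k : ℝ) : ℝ := 4 / (k * π) * √α * ellE k

/-- The modulus `k ∈ (0, 1)` of the rotation with action `I`. -/
def rotModulus (α I : ℝ) : ℝ := Function.invFunOn (rotAction α) (Ioo 0 1) I

/-- The frequency `Ω(I)` of the rotation with action `I`. -/
def rotFreq (α I : ℝ) : ℝ :=
  π * √α / (rotModulus α I * ellK (rotModulus α I))

/-- `ζ(I) = dΩ/dI`. -/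
def rotZeta (α I : ℝ) : ℝ := deriv (rotFreq α) I

/-! ### The perturbed system

The pendulum `θ'' + (α - ε cos (τ - τ₀)) sin θ + C₁ ε θ' = 0` reads
`φ' = Ω(I) + ε * fieldPhi`, `I' = ε * fieldI` in the action-angle variables. -/

/-- Coefficient of `ε` in the equation for `φ'`. -/
def fieldPhi (α C₁ τ₀ τ φ I : ℝ) : ℝ :=
  let k := rotModulus α I
  let u := ellK k / π * φ
  π * k / (√α * ellK k) *
      (k ^ 2 * sn u k ^ 2 * cn u k ^ 2 / (1 - k ^ 2)
        - ellZ u k * sn u k * cn u k * dn u k / (1 - k ^ 2)) * cos (τ - τ₀)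
    - C₁ * π / ellK k *
      (k ^ 2 * sn u k * cn u k * dn u k / (1 - k ^ 2)
        - ellZ u k * dn u k ^ 2 / (1 - k ^ 2))

/-- Coefficient of `ε` in the equation for `I'`. -/
def fieldI (α C₁ τ₀ τ φ I : ℝ) : ℝ :=
  let k := rotModulus α I
  let u := ellK k / π * φ
  4 * ellK k / π * cos (τ - τ₀) * (sn u k * cn u k * dn u k)
    - 4 * C₁ * √α * ellK k / (π * k) * dn u k ^ 2

/-! ### Formal power series in `ε` -/

/-- `[h(φ, I)]⁽ⁿ⁾`: the coefficient of `εⁿ` in `h(∑ⱼ εʲ φⱼ, ∑ⱼ εʲ Iⱼ)`; the terms with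
`j > n` of the two series do not contribute to it. -/
def orderCoeff (h : ℝ → ℝ → ℝ) (φ I : ℕ → ℝ) (n : ℕ) : ℝ :=
  iteratedDeriv n (fun ε : ℝ =>
    h (∑ j ∈ Finset.range (n + 1), ε ^ j * φ j)
      (∑ j ∈ Finset.range (n + 1), ε ^ j * I j)) 0 / (n.factorial : ℝ)

/-- `F₁⁽ⁿ⁾(τ)` for `n ≥ 1`, with `k₂` the modulus of the unperturbed rotation. -/
def F₁ (α k₂ C₁ τ₀ : ℝ) (φ I : ℕ → ℝ → ℝ) (n : ℕ) (τ : ℝ) : ℝ :=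
  orderCoeff (fun _ J => rotFreq α J - rotZeta α (rotAction α k₂) * J)
      (fun j => φ j τ) (fun j => I j τ) n
    + orderCoeff (fieldPhi α C₁ τ₀ τ) (fun j => φ j τ) (fun j => I j τ) (n - 1)

/-- `F₂⁽ⁿ⁾(τ)` for `n ≥ 1`. -/
def F₂ (α C₁ τ₀ : ℝ) (φ I : ℕ → ℝ → ℝ) (n : ℕ) (τ : ℝ) : ℝ :=
  orderCoeff (fieldI α C₁ τ₀ τ) (fun j => φ j τ) (fun j => I j τ) (n - 1)

/-- The coefficients `φ n = φ⁽ⁿ⁾`, `I n = I⁽ⁿ⁾` of the formal series solution around the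
unperturbed rotation of modulus `k₂`, with initial conditions `φbar n`, `Ibar n` at the
orders `n ≥ 1`. -/
structure IsFormalSolution (α k₂ C₁ τ₀ : ℝ) (φbar Ibar : ℕ → ℝ) (φ I : ℕ → ℝ → ℝ) :
    Prop where
  phi_zero : ∀ τ, φ 0 τ = π / ellK k₂ * √α * (τ / k₂)
  I_zero : ∀ τ, I 0 τ = rotAction α k₂
  phi_init : ∀ n, 1 ≤ n → φ n 0 = φbar n
  I_init : ∀ n, 1 ≤ n → I n 0 = Ibar n
  phi_deriv : ∀ n, 1 ≤ n → ∀ τ, HasDerivAt (φ n)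
    (rotZeta α (rotAction α k₂) * I n τ + F₁ α k₂ C₁ τ₀ φ I n τ) τ
  I_deriv : ∀ n, 1 ≤ n → ∀ τ, HasDerivAt (I n) (F₂ α C₁ τ₀ φ I n τ) τ

/-! ### Averages and the threshold -/

/-- The average `⟨g⟩` over one period `T`. -/
def avg (T : ℝ) (g : ℝ → ℝ) : ℝ := 1 / T * ∫ τ in (0 : ℝ)..T, g τ

/-- `Δ`, the average of `dn²` along the unperturbed rotation. -/
def Delta (α k₂ : ℝ) : ℝ :=
  √α / (2 * k₂ * ellK k₂) *
    ∫ τ in (0 : ℝ)..(2 * k₂ * ellK k₂ / √α), dn (√α / k₂ * τ) k₂ ^ 2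

/-- `G₁`, an average over the period `T`. -/
def G₁ (α k₂ T : ℝ) : ℝ :=
  avg T fun τ =>
    sn (√α / k₂ * τ) k₂ * cn (√α / k₂ * τ) k₂ * dn (√α / k₂ * τ) k₂ * sin τ

end

end Pendulum

/-! ### Jacobi elliptic functions: derivatives, symmetries and periods -/

namespace Pendulum

/-! First order. Along the unperturbed rotation the action force is a multiple of `cos (τ - τ₀)`
times the odd function sn cn dn, minus a multiple of `C₁ dn²`. Parity kills the `cos τ` part, so the
average is proportional to `sin τ₀ * G₁ - C₁ * √α / k * Delta` (`integral_fieldI`). Since `Delta` is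
positive, this gives (i). The product sn cn dn has period S, with T = 2pS; translation by S
multiplies the integral defining `G₁` by cos S. Hence `G₁ ≠ 0` forces S to be a multiple of 2π, that
is q = 2mp (`exists_eq_of_G₁_ne_zero`), and (iii) follows.

Sign of `G₁`. For p = 1, q = 2m, an integration by parts turns `G₁` into a positive multiple of the
m-th cosine coefficient of dn². The coefficients of dn itself are positive
(`integral_dn_mul_cos_pos`): those of Re dn(u + iv) are the coefficients of dn u times cosh(lv), by
Cauchy–Riemann, while Re dn(u + iv) is a nonnegative kernel of constant mass that concentrates at u
= 0 as iv approaches the pole iK'. For v close enough to K' the cosine integral against it is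
positive. By Parseval, the coefficients of dn² are convolutions of positive sequences
(`integral_sq_mul_cos_pos`).

Higher orders. The coefficient of order n of a composed series is affine in the terms of order n,
with slope the differential at order zero (`orderCoeff_eq_update_add`). Each order leaves two free
constants. The one of the action makes the angle periodic, because Ω' ≠ 0; the one of the angle
cancels the average of the next action force, because the phase derivative of the averaged force is
proportional to `cos τ₀ * G₁` (`integral_deriv_fieldI`). The strict bound on |C₁| gives |sin τ₀| <
1, hence `cos τ₀ ≠ 0`, and `IsResonant.exists_solution` runs the recursion. -/

/-- The delta amplitude `√(1 - k² sin² x)`. -/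
noncomputable def delta (k x : ℝ) : ℝ := √(1 - k ^ 2 * sin x ^ 2)

lemma one_sub_sq_mul_sin_sq_ge {k : ℝ} (x : ℝ) : 1 - k ^ 2 ≤ 1 - k ^ 2 * sin x ^ 2 := by
  nlinarith [sin_sq_le_one x, sq_nonneg k]

lemma one_sub_sq_mul_sin_sq_pos {k : ℝ} (hk : k ^ 2 < 1) (x : ℝ) :
    0 < 1 - k ^ 2 * sin x ^ 2 := by
  linarith [one_sub_sq_mul_sin_sq_ge (k := k) x]

lemma delta_pos {k : ℝ} (hk : k ^ 2 < 1) (x : ℝ) : 0 < delta k x :=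
  sqrt_pos.2 (one_sub_sq_mul_sin_sq_pos hk x)

lemma delta_sq {k : ℝ} (hk : k ^ 2 < 1) (x : ℝ) :
    delta k x ^ 2 = 1 - k ^ 2 * sin x ^ 2 :=
  sq_sqrt (one_sub_sq_mul_sin_sq_pos hk x).le

lemma delta_le_one (k x : ℝ) : delta k x ≤ 1 :=
  sqrt_le_one.2 (by nlinarith [sq_nonneg (k * sin x)])

lemma continuous_delta (k : ℝ) : Continuous (delta k) := by
  unfold delta; fun_prop

lemma delta_neg (k x : ℝ) : delta k (-x) = delta k x := by simp [delta]

lemma delta_add_pi (k x : ℝ) : delta k (x + π) = delta k x := by simp [delta]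

lemma delta_pi_sub (k x : ℝ) : delta k (π - x) = delta k x := by simp [delta]

lemma hasDerivAt_delta {k : ℝ} (hk : k ^ 2 < 1) (x : ℝ) :
    HasDerivAt (delta k) (-(k ^ 2 * sin x * cos x) / delta k x) x := by
  have h := (((hasDerivAt_sin x).pow 2).const_mul (k ^ 2)).const_sub 1
  have h2 := h.sqrt (one_sub_sq_mul_sin_sq_pos hk x).ne'
  refine h2.congr_deriv ?_
  have := (delta_pos hk x).ne'
  change _ / (2 * delta k x) = _
  field_simp
  simp
  ring

lemma continuous_one_div_delta {k : ℝ} (hk : k ^ 2 < 1) :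
    Continuous fun x => 1 / delta k x :=
  continuous_const.div (continuous_delta k) fun x => (delta_pos hk x).ne'

lemma ellF_eq (k x : ℝ) : ellF k x = ∫ ψ in (0 : ℝ)..x, 1 / delta k ψ := rfl

lemma hasDerivAt_ellF {k : ℝ} (hk : k ^ 2 < 1) (x : ℝ) :
    HasDerivAt (ellF k) (1 / delta k x) x :=
  intervalIntegral.integral_hasDerivAt_right
    ((continuous_one_div_delta hk).intervalIntegrable _ _)
    (continuous_one_div_delta hk).stronglyMeasurable.stronglyMeasurableAtFilter
    (continuous_one_div_delta hk).continuousAt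

lemma strictMono_ellF {k : ℝ} (hk : k ^ 2 < 1) : StrictMono (ellF k) :=
  strictMono_of_deriv_pos fun x => by
    rw [(hasDerivAt_ellF hk x).deriv]; exact one_div_pos.2 (delta_pos hk x)

lemma continuous_ellF {k : ℝ} (hk : k ^ 2 < 1) : Continuous (ellF k) :=
  continuous_iff_continuousAt.2 fun x => (hasDerivAt_ellF hk x).continuousAt

@[simp] lemma ellF_zero (k : ℝ) : ellF k 0 = 0 := by simp [ellF]

lemma ellF_neg (k x : ℝ) : ellF k (-x) = -ellF k x := by
  have := intervalIntegral.integral_comp_neg (a := 0) (b := x) (fun ψ => 1 / delta k ψ)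
  simp only [delta_neg, neg_zero] at this
  rw [ellF_eq, ellF_eq, this, intervalIntegral.integral_symm]

lemma integral_pi_of_symm {f : ℝ → ℝ} (hf : Continuous f) (h : ∀ x, f (π - x) = f x) :
    ∫ x in (0 : ℝ)..π, f x = 2 * ∫ x in (0 : ℝ)..(π / 2), f x := by
  have h1 : ∫ x in (π / 2)..π, f x = ∫ x in (0 : ℝ)..(π / 2), f x := by
    have := intervalIntegral.integral_comp_sub_left (a := 0) (b := π / 2) f π
    simp only [h, sub_zero] at this
    rw [this]; congr 1; ring
  rw [← intervalIntegral.integral_add_adjacent_intervals (hf.intervalIntegrable 0 (π / 2))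
    (hf.intervalIntegrable (π / 2) π), h1]
  ring

/-- Common source of the quasi-periods 2K and 2E: the increment over a period π is twice the quarter
integral, by reflection in π/2. -/
lemma integral_add_pi_of_symm {f : ℝ → ℝ} (hf : Continuous f) (h : ∀ x, f (π - x) = f x)
    (hp : ∀ x, f (x + π) = f x) (x : ℝ) :
    ∫ y in (0 : ℝ)..(x + π), f y = (∫ y in (0 : ℝ)..x, f y) +
      2 * ∫ y in (0 : ℝ)..(π / 2), f y := by
  have hper : Function.Periodic f π := hp
  rw [← intervalIntegral.integral_add_adjacent_intervals (hf.intervalIntegrable 0 x)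
    (hf.intervalIntegrable x (x + π)), hper.intervalIntegral_add_eq x 0, zero_add,
    integral_pi_of_symm hf h]

lemma ellF_add_pi {k : ℝ} (hk : k ^ 2 < 1) (x : ℝ) :
    ellF k (x + π) = ellF k x + 2 * ellK k :=
  integral_add_pi_of_symm (continuous_one_div_delta hk)
    (fun x => by rw [delta_pi_sub]) (fun x => by rw [delta_add_pi]) x

lemma le_ellF {k : ℝ} (hk : k ^ 2 < 1) {x : ℝ} (hx : 0 ≤ x) : x ≤ ellF k x := by
  have : ∫ _ in (0 : ℝ)..x, (1 : ℝ) ≤ ellF k x :=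
    intervalIntegral.integral_mono_on hx (by simp)
      ((continuous_one_div_delta hk).intervalIntegrable _ _)
      fun y _ => (one_le_div (delta_pos hk y)).2 (delta_le_one k y)
  simpa using this

lemma ellK_pos {k : ℝ} (hk : k ^ 2 < 1) : 0 < ellK k :=
  lt_of_lt_of_le (by positivity) (le_ellF hk (by positivity : (0 : ℝ) ≤ π / 2))

lemma surjective_ellF {k : ℝ} (hk : k ^ 2 < 1) : Function.Surjective (ellF k) := by
  refine (continuous_ellF hk).surjective ?_ ?_
  · refine Filter.tendsto_atTop_mono' _ ?_ Filter.tendsto_id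
    filter_upwards [Filter.eventually_ge_atTop 0] with x hx using le_ellF hk hx
  · refine Filter.tendsto_atBot_mono' _ ?_ Filter.tendsto_id
    filter_upwards [Filter.eventually_le_atBot 0] with x hx
    have := le_ellF hk (neg_nonneg.2 hx)
    rw [ellF_neg] at this
    simpa using neg_le_neg this

lemma ellF_am {k : ℝ} (hk : k ^ 2 < 1) (u : ℝ) : ellF k (am u k) = u :=
  Function.invFun_eq (surjective_ellF hk u)

lemma am_ellF {k : ℝ} (hk : k ^ 2 < 1) (x : ℝ) : am (ellF k x) k = x :=
  Function.leftInverse_invFun (strictMono_ellF hk).injective x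

lemma am_eq_of_ellF_eq {k : ℝ} (hk : k ^ 2 < 1) {u x : ℝ} (h : ellF k x = u) : am u k = x := by
  rw [← h, am_ellF hk]

lemma am_zero {k : ℝ} (hk : k ^ 2 < 1) : am 0 k = 0 := am_eq_of_ellF_eq hk (ellF_zero k)

lemma am_ellK {k : ℝ} (hk : k ^ 2 < 1) : am (ellK k) k = π / 2 := am_eq_of_ellF_eq hk rfl

lemma am_neg {k : ℝ} (hk : k ^ 2 < 1) (u : ℝ) : am (-u) k = -am u k :=
  am_eq_of_ellF_eq hk (by rw [ellF_neg, ellF_am hk])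

lemma am_add {k : ℝ} (hk : k ^ 2 < 1) (u : ℝ) : am (u + 2 * ellK k) k = am u k + π :=
  am_eq_of_ellF_eq hk (by rw [ellF_add_pi hk, ellF_am hk])

lemma strictMono_am {k : ℝ} (hk : k ^ 2 < 1) : StrictMono fun u => am u k := by
  intro u v huv
  rw [← (strictMono_ellF hk).lt_iff_lt, ellF_am hk, ellF_am hk]
  exact huv

lemma continuous_am {k : ℝ} (hk : k ^ 2 < 1) : Continuous fun u => am u k :=
  (strictMono_am hk).monotone.continuous_of_surjective
    fun x => ⟨ellF k x, am_ellF hk x⟩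

lemma dn_eq_delta (u k : ℝ) : dn u k = delta k (am u k) := rfl

lemma dn_pos {k : ℝ} (hk : k ^ 2 < 1) (u : ℝ) : 0 < dn u k := delta_pos hk _

lemma dn_sq {k : ℝ} (hk : k ^ 2 < 1) (u : ℝ) : dn u k ^ 2 = 1 - k ^ 2 * sn u k ^ 2 :=
  delta_sq hk _

lemma cn_sq (u k : ℝ) : cn u k ^ 2 = 1 - sn u k ^ 2 := cos_sq' _

lemma hasDerivAt_am {k : ℝ} (hk : k ^ 2 < 1) (u : ℝ) :
    HasDerivAt (fun u => am u k) (dn u k) u := by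
  have h := HasDerivAt.of_local_left_inverse (f := ellF k) (g := fun u => am u k) (a := u)
    (continuous_am hk).continuousAt (hasDerivAt_ellF hk _)
    (one_div_pos.2 (delta_pos hk _)).ne' (Filter.Eventually.of_forall (ellF_am hk))
  simpa [dn_eq_delta] using h

lemma hasDerivAt_sn {k : ℝ} (hk : k ^ 2 < 1) (u : ℝ) :
    HasDerivAt (fun u => sn u k) (cn u k * dn u k) u :=
  (hasDerivAt_am hk u).sin

lemma hasDerivAt_cn {k : ℝ} (hk : k ^ 2 < 1) (u : ℝ) :
    HasDerivAt (fun u => cn u k) (-(sn u k * dn u k)) u :=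
  (hasDerivAt_am hk u).cos.congr_deriv (by simp [sn])

lemma hasDerivAt_dn {k : ℝ} (hk : k ^ 2 < 1) (u : ℝ) :
    HasDerivAt (fun u => dn u k) (-(k ^ 2 * sn u k * cn u k)) u := by
  refine ((hasDerivAt_delta hk (am u k)).comp u (hasDerivAt_am hk u)).congr_deriv ?_
  have := (delta_pos hk (am u k)).ne'
  rw [dn_eq_delta, div_mul_cancel₀ _ this]; rfl

lemma continuous_sn {k : ℝ} (hk : k ^ 2 < 1) : Continuous fun u => sn u k :=
  continuous_sin.comp (continuous_am hk)

lemma continuous_cn {k : ℝ} (hk : k ^ 2 < 1) : Continuous fun u => cn u k :=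
  continuous_cos.comp (continuous_am hk)

lemma continuous_dn {k : ℝ} (hk : k ^ 2 < 1) : Continuous fun u => dn u k :=
  (continuous_delta k).comp (continuous_am hk)

lemma sn_neg {k : ℝ} (hk : k ^ 2 < 1) (u : ℝ) : sn (-u) k = -sn u k := by simp [sn, am_neg hk]
lemma cn_neg {k : ℝ} (hk : k ^ 2 < 1) (u : ℝ) : cn (-u) k = cn u k := by simp [cn, am_neg hk]
lemma dn_neg {k : ℝ} (hk : k ^ 2 < 1) (u : ℝ) : dn (-u) k = dn u k := by
  simp [dn, sn_neg hk]

lemma sn_add {k : ℝ} (hk : k ^ 2 < 1) (u : ℝ) : sn (u + 2 * ellK k) k = -sn u k := by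
  simp [sn, am_add hk]
lemma cn_add {k : ℝ} (hk : k ^ 2 < 1) (u : ℝ) : cn (u + 2 * ellK k) k = -cn u k := by
  simp [cn, am_add hk]
lemma dn_add {k : ℝ} (hk : k ^ 2 < 1) (u : ℝ) : dn (u + 2 * ellK k) k = dn u k := by
  simp [dn, sn_add hk]

/-- `E(u, k)` is the incomplete integral of the second kind of the amplitude of `u`. -/
lemma ellEinc_eq {k : ℝ} (hk : k ^ 2 < 1) (u : ℝ) :
    ellEinc u k = ∫ ψ in (0 : ℝ)..(am u k), delta k ψ := by
  have h (v : ℝ) : HasDerivAt (fun v => ∫ ψ in (0 : ℝ)..(am v k), delta k ψ) (dn v k ^ 2) v := by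
    have h1 : HasDerivAt (fun x => ∫ ψ in (0 : ℝ)..x, delta k ψ) (delta k (am v k)) (am v k) :=
      intervalIntegral.integral_hasDerivAt_right ((continuous_delta k).intervalIntegrable _ _)
        (continuous_delta k).stronglyMeasurable.stronglyMeasurableAtFilter
        (continuous_delta k).continuousAt
    exact (h1.comp v (hasDerivAt_am hk v)).congr_deriv (by rw [dn_eq_delta]; ring)
  rw [ellEinc, intervalIntegral.integral_eq_sub_of_hasDerivAt (fun v _ => h v)
    (((continuous_dn hk).pow 2).intervalIntegrable _ _), am_zero hk]
  simp

lemma ellEinc_add {k : ℝ} (hk : k ^ 2 < 1) (u : ℝ) :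
    ellEinc (u + 2 * ellK k) k = ellEinc u k + 2 * ellE k := by
  rw [ellEinc_eq hk, ellEinc_eq hk, am_add hk]
  exact integral_add_pi_of_symm (continuous_delta k) (delta_pi_sub k) (delta_add_pi k) _

/-- The slope E/K in the zeta function is exactly what cancels the increment 2E of `ellEinc`. This
makes `fieldPhi` periodic in the angle. -/
lemma ellZ_add {k : ℝ} (hk : k ^ 2 < 1) (u : ℝ) : ellZ (u + 2 * ellK k) k = ellZ u k := by
  have := (ellK_pos hk).ne'
  rw [ellZ, ellZ, ellEinc_add hk]
  field_simp
  ring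

end Pendulum

/-! ### Joint smoothness in the argument and the modulus -/

namespace Pendulum

open scoped ContDiff Topology
open MeasureTheory

lemma continuousOn_slice {E F : Type*} [TopologicalSpace E] [TopologicalSpace F]
    {g : E × ℝ → F} {U : Set E} (hg : ContinuousOn g (U ×ˢ univ)) {p : E}
    (hp : p ∈ U) : Continuous fun t => g (p, t) := by
  rw [← continuousOn_univ]
  exact hg.comp (by fun_prop) fun t _ => ⟨hp, mem_univ _⟩

section ParametricIntegral

universe u

variable {E F : Type u} [NormedAddCommGroup E] [NormedSpace ℝ E] [ProperSpace E]
  [NormedAddCommGroup F] [NormedSpace ℝ F]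

lemma hasFDerivAt_parametric_integral {g : E × ℝ → F} {U : Set E} (hU : IsOpen U)
    (hg : ContDiffOn ℝ 1 g (U ×ˢ univ)) {p : E} (hp : p ∈ U) :
    HasFDerivAt (fun p => ∫ t in (0 : ℝ)..1, g (p, t))
      (∫ t in (0 : ℝ)..1, (fderiv ℝ g (p, t)).comp (ContinuousLinearMap.inl ℝ E ℝ)) p := by
  have hopen : IsOpen (U ×ˢ (univ : Set ℝ)) := hU.prod isOpen_univ
  have hcont : ContinuousOn (fun q => (fderiv ℝ g q).comp (ContinuousLinearMap.inl ℝ E ℝ))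
      (U ×ˢ univ) :=
    (hg.continuousOn_fderiv_of_isOpen hopen le_rfl).clm_comp continuousOn_const
  obtain ⟨r, hr, hrU⟩ := Metric.nhds_basis_closedBall.mem_iff.1 (hU.mem_nhds hp)
  obtain ⟨C, hC⟩ := ((isCompact_closedBall p r).prod (isCompact_Icc (a := (0 : ℝ)) (b := 1)))
    |>.exists_bound_of_continuousOn
      (hcont.mono (prod_mono hrU (subset_univ _)))
  refine intervalIntegral.hasFDerivAt_integral_of_dominated_of_fderiv_le
    (F := fun p t => g (p, t))
    (F' := fun p t => (fderiv ℝ g (p, t)).comp (ContinuousLinearMap.inl ℝ E ℝ))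
    (bound := fun _ => C) (Metric.closedBall_mem_nhds p hr) ?_ ?_ ?_ ?_ (by simp) ?_
  · filter_upwards [hU.mem_nhds hp] with x hx
    exact (continuousOn_slice hg.continuousOn hx).aestronglyMeasurable
  · exact (continuousOn_slice hg.continuousOn hp).intervalIntegrable _ _
  · exact (continuousOn_slice hcont hp).aestronglyMeasurable
  · refine Filter.Eventually.of_forall fun t ht x hx => hC (x, t) ⟨hx, ?_⟩
    rw [uIoc_of_le zero_le_one] at ht
    exact ⟨ht.1.le, ht.2⟩
  · refine Filter.Eventually.of_forall fun t _ x hx => ?_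
    have h1 : HasFDerivAt g (fderiv ℝ g (x, t)) (x, t) :=
      ((hg.differentiableOn one_ne_zero).differentiableAt
        (hopen.mem_nhds ⟨hrU hx, mem_univ t⟩)).hasFDerivAt
    exact h1.comp x (hasFDerivAt_prodMk_left x t)

/-- Induction on the order: the derivative of the integral is the integral of the partial
derivative, which takes values in `E →L[ℝ] F`. This is why `F` is generalized and shares its
universe with `E`. -/
theorem contDiffOn_parametric_integral_nat (n : ℕ) {g : E × ℝ → F} {U : Set E} (hU : IsOpen U)
    (hg : ContDiffOn ℝ n g (U ×ˢ univ)) :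
    ContDiffOn ℝ n (fun p => ∫ t in (0 : ℝ)..1, g (p, t)) U := by
  induction n generalizing F with
  | zero =>
    rw [Nat.cast_zero, contDiffOn_zero] at hg ⊢
    rw [continuousOn_iff_continuous_domRestrict]
    refine intervalIntegral.continuous_parametric_intervalIntegral_of_continuous'
      (f := fun (p : U) t => g (p, t)) ?_ 0 1
    rw [← continuousOn_univ]
    exact hg.comp (by fun_prop) fun q _ => ⟨q.1.2, mem_univ _⟩
  | succ n ih =>
    have hopen : IsOpen (U ×ˢ (univ : Set ℝ)) := hU.prod isOpen_univ
    have h1 : ContDiffOn ℝ 1 g (U ×ˢ univ) := hg.of_le (by simp)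
    push_cast at hg ⊢
    rw [contDiffOn_succ_iff_fderiv_of_isOpen hU]
    refine ⟨fun p hp =>
      (hasFDerivAt_parametric_integral hU h1 hp).differentiableAt.differentiableWithinAt,
      by simp, ?_⟩
    have h2 : ContDiffOn ℝ n (fun q => (fderiv ℝ g q).comp (ContinuousLinearMap.inl ℝ E ℝ))
        (U ×ˢ univ) :=
      (hg.fderiv_of_isOpen hopen le_rfl).clm_comp contDiffOn_const
    exact (ih h2).congr fun p hp => (hasFDerivAt_parametric_integral hU h1 hp).fderiv

theorem contDiffOn_parametric_integral {g : E × ℝ → F} {U : Set E} (hU : IsOpen U)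
    (hg : ContDiffOn ℝ ∞ g (U ×ˢ univ)) :
    ContDiffOn ℝ ∞ (fun p => ∫ t in (0 : ℝ)..1, g (p, t)) U :=
  contDiffOn_infty.2 fun n => contDiffOn_parametric_integral_nat n hU (contDiffOn_infty.1 hg n)

end ParametricIntegral

/-- Primitives of functions which are smooth jointly with a parameter are jointly smooth. -/
theorem contDiffOn_primitive {g : ℝ × ℝ → ℝ} {S : Set ℝ} (hS : IsOpen S)
    (hg : ContDiffOn ℝ ∞ g (univ ×ˢ S)) :
    ContDiffOn ℝ ∞ (fun p : ℝ × ℝ => ∫ t in (0 : ℝ)..p.1, g (t, p.2)) (univ ×ˢ S) := by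
  -- Rescaling to the fixed interval [0, 1] moves the variable endpoint into the integrand.
  have h : ContDiffOn ℝ ∞ (fun p : ℝ × ℝ => ∫ t in (0 : ℝ)..1, p.1 * g (p.1 * t, p.2))
      (univ ×ˢ S) := by
    refine contDiffOn_parametric_integral
      (g := fun q : (ℝ × ℝ) × ℝ => q.1.1 * g (q.1.1 * q.2, q.1.2)) (isOpen_univ.prod hS) ?_
    refine (by fun_prop : ContDiff ℝ ∞ fun q : (ℝ × ℝ) × ℝ => q.1.1).contDiffOn.mul ?_
    exact hg.comp (by fun_prop : ContDiff ℝ ∞ fun q : (ℝ × ℝ) × ℝ =>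
      (q.1.1 * q.2, q.1.2)).contDiffOn fun q hq => ⟨mem_univ _, hq.1.2⟩
  refine h.congr fun p _ => ?_
  have := intervalIntegral.mul_integral_comp_mul_left (a := 0) (b := 1) (c := p.1)
    (f := fun t => g (t, p.2))
  simp only [mul_zero, mul_one] at this
  rw [← this, intervalIntegral.integral_const_mul]

/-- The moduli of the elliptic functions. -/
def moduli : Set ℝ := {k | k ^ 2 < 1}

lemma isOpen_moduli : IsOpen moduli := isOpen_lt (by fun_prop) continuous_const

lemma contDiffOn_delta : ContDiffOn ℝ ∞ (fun p : ℝ × ℝ => delta p.2 p.1) (univ ×ˢ moduli) := by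
  unfold delta
  refine ContDiffOn.sqrt (by fun_prop) fun p hp => (one_sub_sq_mul_sin_sq_pos hp.2 p.1).ne'

lemma contDiffOn_ellF : ContDiffOn ℝ ∞ (fun p : ℝ × ℝ => ellF p.2 p.1) (univ ×ˢ moduli) :=
  contDiffOn_primitive isOpen_moduli
    (contDiffOn_const.div contDiffOn_delta fun p hp => (delta_pos hp.2 p.1).ne')

lemma contDiffOn_ellK : ContDiffOn ℝ ∞ ellK moduli :=
  contDiffOn_ellF.comp (contDiff_const.prodMk contDiff_id).contDiffOn
    fun _ hk => ⟨mem_univ (π / 2), hk⟩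

lemma contDiffOn_ellE : ContDiffOn ℝ ∞ ellE moduli :=
  (contDiffOn_primitive isOpen_moduli contDiffOn_delta).comp
    (contDiff_const.prodMk contDiff_id).contDiffOn fun _ hk => ⟨mem_univ (π / 2), hk⟩

/-- Inverse function theorem for (x, k) ↦ (`ellF k x`, k). Its differential is triangular, with
diagonal entries 1 / `delta` and 1, hence invertible. -/
lemma contDiffOn_am : ContDiffOn ℝ ∞ (fun p : ℝ × ℝ => am p.1 p.2) (univ ×ˢ moduli) := by
  rintro ⟨u, k⟩ ⟨-, hk⟩
  apply ContDiffAt.contDiffWithinAt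
  set Φ : ℝ × ℝ → ℝ × ℝ := fun p => (ellF p.2 p.1, p.2) with hΦ
  set a : ℝ × ℝ := (am u k, k)
  have hΦa : Φ a = (u, k) := by simp [hΦ, a, ellF_am hk]
  have hopen : IsOpen ((univ : Set ℝ) ×ˢ moduli) := isOpen_univ.prod isOpen_moduli
  have hF : ContDiffAt ℝ ∞ (fun p : ℝ × ℝ => ellF p.2 p.1) a :=
    contDiffOn_ellF.contDiffAt (hopen.mem_nhds ⟨mem_univ _, hk⟩)
  have hs : ContDiffAt ℝ ∞ Φ a := hF.prodMk contDiffAt_snd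
  have hF' := (hF.differentiableAt (by simp)).hasFDerivAt
  set L := fderiv ℝ (fun p : ℝ × ℝ => ellF p.2 p.1) a
  have hL : L (1, 0) = 1 / delta k (am u k) := by
    have h1 := hF'.comp_hasDerivAt (am u k) ((hasDerivAt_id (am u k)).prodMk
      (hasDerivAt_const (am u k) k))
    exact h1.unique (hasDerivAt_ellF hk _)
  have hinj : Function.Injective ((L.prod (ContinuousLinearMap.snd ℝ ℝ ℝ) :
      ℝ × ℝ →L[ℝ] ℝ × ℝ) : ℝ × ℝ →ₗ[ℝ] ℝ × ℝ) := by
    refine (injective_iff_map_eq_zero _).2 ?_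
    rintro ⟨x, y⟩ h
    have h0 : L (x, y) = 0 ∧ y = 0 := by simpa using h
    obtain ⟨h0, rfl⟩ := h0
    have h1 : L (x, 0) = x * L (1, 0) := by
      rw [← smul_eq_mul, ← map_smul]; simp
    rw [h1, hL] at h0
    have := (delta_pos hk (am u k)).ne'
    simpa [this] using h0
  let e : (ℝ × ℝ) ≃L[ℝ] (ℝ × ℝ) := (LinearEquiv.ofInjectiveEndo _ hinj).toContinuousLinearEquiv
  have hs' : HasFDerivAt Φ (e : ℝ × ℝ →L[ℝ] ℝ × ℝ) a := by
    have : (e : ℝ × ℝ →L[ℝ] ℝ × ℝ) = L.prod (ContinuousLinearMap.snd ℝ ℝ ℝ) := by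
      ext <;> simp [e]
    rw [this]
    exact hF'.prodMk hasFDerivAt_snd
  have hloc := hs.to_localInverse hs' (by simp)
  rw [hΦa] at hloc
  have hri := (hs.hasStrictFDerivAt' hs' (by simp)).eventually_right_inverse
  rw [hΦa] at hri
  refine (contDiffAt_fst.comp _ hloc).congr_of_eventuallyEq ?_
  -- The local inverse preserves the modulus, so its first component solves `ellF q.2 x = q.1`;
  -- injectivity of `ellF` identifies it with the globally chosen `am`.
  filter_upwards [hri, hopen.mem_nhds (⟨mem_univ u, hk⟩ : (u, k) ∈ univ ×ˢ moduli)] with q hq hq2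
  have h1 : ellF _ _ = q.1 := congrArg Prod.fst hq
  have h2 : _ = q.2 := congrArg Prod.snd hq
  change ((hs.hasStrictFDerivAt' hs' (by simp)).localInverse Φ e a q).2 = q.2 at h2
  rw [h2] at h1
  exact am_eq_of_ellF_eq hq2.2 h1

lemma contDiffOn_sn : ContDiffOn ℝ ∞ (fun p : ℝ × ℝ => sn p.1 p.2) (univ ×ˢ moduli) :=
  contDiffOn_am.sin

lemma contDiffOn_cn : ContDiffOn ℝ ∞ (fun p : ℝ × ℝ => cn p.1 p.2) (univ ×ˢ moduli) :=
  contDiffOn_am.cos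

lemma contDiffOn_dn : ContDiffOn ℝ ∞ (fun p : ℝ × ℝ => dn p.1 p.2) (univ ×ˢ moduli) :=
  contDiffOn_delta.comp (contDiffOn_am.prodMk contDiffOn_snd) fun _ hp => ⟨mem_univ _, hp.2⟩

lemma contDiffOn_ellZ : ContDiffOn ℝ ∞ (fun p : ℝ × ℝ => ellZ p.1 p.2) (univ ×ˢ moduli) := by
  refine (contDiffOn_primitive isOpen_moduli (contDiffOn_dn.pow 2)).sub
    (ContDiffOn.mul (ContDiffOn.div ?_ ?_ fun p hp => (ellK_pos hp.2).ne') contDiffOn_fst)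
  · exact contDiffOn_ellE.comp contDiffOn_snd fun _ hp => hp.2
  · exact contDiffOn_ellK.comp contDiffOn_snd fun _ hp => hp.2

end Pendulum

/-! ### Action, frequency, and regularity of the perturbing fields -/

namespace Pendulum

open scoped ContDiff Topology

lemma sq_lt_one_of_mem {k : ℝ} (hk : k ∈ Ioo (0 : ℝ) 1) : k ^ 2 < 1 := by
  nlinarith [hk.1, hk.2]

lemma delta_antitoneOn (x : ℝ) : AntitoneOn (fun k => delta k x) (Ioo 0 1) := by
  intro k hk l hl hkl
  refine sqrt_le_sqrt ?_
  have := pow_le_pow_left₀ hk.1.le hkl 2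
  nlinarith [sq_nonneg (sin x)]

lemma ellE_antitoneOn : AntitoneOn ellE (Ioo 0 1) := fun k hk l hl hkl =>
  intervalIntegral.integral_mono_on (by positivity)
    ((continuous_delta l).intervalIntegrable _ _) ((continuous_delta k).intervalIntegrable _ _)
    fun x _ => delta_antitoneOn x hk hl hkl

lemma ellK_monotoneOn : MonotoneOn ellK (Ioo 0 1) := fun k hk l hl hkl =>
  intervalIntegral.integral_mono_on (by positivity)
    ((continuous_one_div_delta (sq_lt_one_of_mem hk)).intervalIntegrable _ _)
    ((continuous_one_div_delta (sq_lt_one_of_mem hl)).intervalIntegrable _ _)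
    fun x _ => one_div_le_one_div_of_le (delta_pos (sq_lt_one_of_mem hl) x)
      (delta_antitoneOn x hk hl hkl)

lemma ellE_pos {k : ℝ} (hk : k ^ 2 < 1) : 0 < ellE k :=
  intervalIntegral.intervalIntegral_pos_of_pos ((continuous_delta k).intervalIntegrable _ _)
    (delta_pos hk) (by positivity)

lemma contDiffAt_ellK {k : ℝ} (hk : k ∈ Ioo (0 : ℝ) 1) : ContDiffAt ℝ ∞ ellK k :=
  contDiffOn_ellK.contDiffAt (isOpen_moduli.mem_nhds (sq_lt_one_of_mem hk))

lemma contDiffAt_ellE {k : ℝ} (hk : k ∈ Ioo (0 : ℝ) 1) : ContDiffAt ℝ ∞ ellE k :=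
  contDiffOn_ellE.contDiffAt (isOpen_moduli.mem_nhds (sq_lt_one_of_mem hk))

lemma hasDerivAt_ellE {k : ℝ} (hk : k ∈ Ioo (0 : ℝ) 1) : HasDerivAt ellE (deriv ellE k) k :=
  ((contDiffAt_ellE hk).differentiableAt (by simp)).hasDerivAt

lemma hasDerivAt_ellK {k : ℝ} (hk : k ∈ Ioo (0 : ℝ) 1) : HasDerivAt ellK (deriv ellK k) k :=
  ((contDiffAt_ellK hk).differentiableAt (by simp)).hasDerivAt

lemma deriv_ellE_nonpos {k : ℝ} (hk : k ∈ Ioo (0 : ℝ) 1) : deriv ellE k ≤ 0 := by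
  rw [← derivWithin_of_isOpen isOpen_Ioo hk]
  exact ellE_antitoneOn.derivWithin_nonpos

lemma deriv_ellK_nonneg {k : ℝ} (hk : k ∈ Ioo (0 : ℝ) 1) : 0 ≤ deriv ellK k := by
  rw [← derivWithin_of_isOpen isOpen_Ioo hk]
  exact ellK_monotoneOn.derivWithin_nonneg

variable {α k : ℝ}

lemma contDiffAt_rotAction (hk : k ∈ Ioo (0 : ℝ) 1) : ContDiffAt ℝ ∞ (rotAction α) k := by
  have hk0 : k * π ≠ 0 := mul_ne_zero hk.1.ne' pi_ne_zero
  have h : ContDiffAt ℝ ∞ (fun l : ℝ => l * π) k := by fun_prop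
  exact ((contDiffAt_const.div h hk0).mul
    contDiffAt_const).mul (contDiffAt_ellE hk)

lemma hasDerivAt_rotAction (hk : k ∈ Ioo (0 : ℝ) 1) :
    HasDerivAt (rotAction α) (4 * √α / π * ((k * deriv ellE k - ellE k) / k ^ 2)) k := by
  have hk0 := hk.1.ne'
  have h := ((hasDerivAt_ellE hk).div (hasDerivAt_id k) hk0).const_mul (4 * √α / π)
  refine (h.congr_deriv ?_).congr_of_eventuallyEq ?_
  · simp only [id]; ring
  · refine Filter.Eventually.of_forall fun l => ?_
    simp only [rotAction, Pi.div_apply, id, div_eq_mul_inv, mul_inv]; ring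

/-- The action is a positive multiple of E(k)/k, where E is positive and nonincreasing. -/
lemma deriv_rotAction_neg (hα : 0 < α) (hk : k ∈ Ioo (0 : ℝ) 1) : deriv (rotAction α) k < 0 := by
  rw [(hasDerivAt_rotAction hk).deriv]
  have h1 := ellE_pos (sq_lt_one_of_mem hk)
  have h2 := mul_nonneg hk.1.le (neg_nonneg.2 (deriv_ellE_nonpos hk))
  have hk0 := hk.1
  exact mul_neg_of_pos_of_neg (by positivity) (div_neg_of_neg_of_pos (by linarith) (by positivity))

lemma strictAntiOn_rotAction (hα : 0 < α) : StrictAntiOn (rotAction α) (Ioo 0 1) :=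
  strictAntiOn_of_deriv_neg (convex_Ioo 0 1)
    (fun _ hk => (contDiffAt_rotAction hk).continuousAt.continuousWithinAt)
    fun k hk => deriv_rotAction_neg hα (by rwa [interior_Ioo] at hk)

lemma rotModulus_rotAction (hα : 0 < α) (hk : k ∈ Ioo (0 : ℝ) 1) :
    rotModulus α (rotAction α k) = k :=
  (strictAntiOn_rotAction hα).injOn.leftInvOn_invFunOn hk

/-- `rotModulus` is a choice of preimage, with a junk value outside the range of `rotAction`. Near a
genuine action the smooth local inverse stays in (0, 1), where injectivity makes it agree with that
choice. -/
lemma contDiffAt_rotModulus (hα : 0 < α) (hk : k ∈ Ioo (0 : ℝ) 1) :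
    ContDiffAt ℝ ∞ (rotModulus α) (rotAction α k) := by
  have hd := (deriv_rotAction_neg hα hk).ne
  have hs := contDiffAt_rotAction (α := α) hk
  have hs' : HasFDerivAt (rotAction α)
      (ContinuousLinearEquiv.unitsEquivAut ℝ (Units.mk0 _ hd) : ℝ →L[ℝ] ℝ) k :=
    ((hs.differentiableAt (by simp)).hasDerivAt).hasFDerivAt_equiv hd
  have hloc := hs.to_localInverse hs' (by simp)
  have hri := (hs.hasStrictFDerivAt' hs' (by simp)).eventually_right_inverse
  have hmem : ∀ᶠ J in 𝓝 (rotAction α k), hs.localInverse hs' (by simp) J ∈ Ioo (0 : ℝ) 1 := by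
    refine hloc.continuousAt.eventually_mem ?_
    rw [hs.localInverse_apply_image]
    exact isOpen_Ioo.mem_nhds hk
  refine hloc.congr_of_eventuallyEq ?_
  filter_upwards [hri, hmem] with J h1 h2
  conv_lhs => rw [← h1]
  exact rotModulus_rotAction hα h2

lemma rotModulus_mem (hα : 0 < α) (hk : k ∈ Ioo (0 : ℝ) 1) :
    ∀ᶠ J in 𝓝 (rotAction α k), rotModulus α J ∈ Ioo (0 : ℝ) 1 := by
  refine (contDiffAt_rotModulus hα hk).continuousAt.eventually_mem ?_
  rw [rotModulus_rotAction hα hk]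
  exact isOpen_Ioo.mem_nhds hk

lemma contDiffAt_rotFreq (hα : 0 < α) (hk : k ∈ Ioo (0 : ℝ) 1) :
    ContDiffAt ℝ ∞ (rotFreq α) (rotAction α k) := by
  have hm := contDiffAt_rotModulus hα hk
  have hK : ContDiffAt ℝ ∞ (fun J => ellK (rotModulus α J)) (rotAction α k) := by
    refine ContDiffAt.comp (rotAction α k) (g := ellK) ?_ hm
    rw [rotModulus_rotAction hα hk]
    exact contDiffAt_ellK hk
  change ContDiffAt ℝ ∞ (fun J => π * √α / (rotModulus α J * ellK (rotModulus α J))) _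
  refine contDiffAt_const.div (hm.mul hK) ?_
  rw [rotModulus_rotAction hα hk]
  exact mul_ne_zero hk.1.ne' (ellK_pos (sq_lt_one_of_mem hk)).ne'

/-- The frequency of the rotations is not isochronous. -/
lemma rotZeta_ne_zero (hα : 0 < α) (hk : k ∈ Ioo (0 : ℝ) 1) : rotZeta α (rotAction α k) ≠ 0 := by
  have h1 : HasDerivAt (fun l => rotFreq α (rotAction α l))
      (rotZeta α (rotAction α k) * deriv (rotAction α) k) k :=
    (((contDiffAt_rotFreq hα hk).differentiableAt (by simp)).hasDerivAt).comp k
      ((contDiffAt_rotAction hk).differentiableAt (by simp)).hasDerivAt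
  have hK := ellK_pos (sq_lt_one_of_mem hk)
  have hk0 := hk.1
  have h2 : HasDerivAt (fun l => π * √α * (l * ellK l)⁻¹)
      (π * √α * (-(1 * ellK k + k * deriv ellK k) / (k * ellK k) ^ 2)) k :=
    (((hasDerivAt_id k).mul (hasDerivAt_ellK hk)).inv
      (mul_ne_zero hk.1.ne' hK.ne')).const_mul (π * √α)
  -- As a function of the modulus the frequency is a multiple of 1 / (l K(l)), and l K(l) has
  -- positive derivative. The chain rule then excludes a zero of dΩ/dI.
  have heq : (fun l => rotFreq α (rotAction α l)) =ᶠ[𝓝 k]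
      fun l => π * √α * (l * ellK l)⁻¹ := by
    filter_upwards [isOpen_Ioo.mem_nhds hk] with l hl
    simp [rotFreq, rotModulus_rotAction hα hl, div_eq_mul_inv]
  have h3 := h1.unique (h2.congr_of_eventuallyEq heq)
  intro h0
  rw [h0, zero_mul] at h3
  have h4 := mul_nonneg hk0.le (deriv_ellK_nonneg hk)
  have h5 : 0 < π * √α * ((ellK k + k * deriv ellK k) / (k * ellK k) ^ 2) := by positivity
  have h6 : π * √α * ((ellK k + k * deriv ellK k) / (k * ellK k) ^ 2) = 0 := by
    have := neg_eq_zero.2 h3.symm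
    rw [← this]; ring
  exact h5.ne' h6

section Fields

variable {C₁ τ₀ : ℝ}

lemma contDiffAt_angle (hα : 0 < α) (hk : k ∈ Ioo (0 : ℝ) 1) (τ x : ℝ) :
    ContDiffAt ℝ ∞ (fun q : ℝ × ℝ × ℝ =>
      (ellK (rotModulus α q.2.2) / π * q.2.1, rotModulus α q.2.2)) (τ, x, rotAction α k) ∧
    ContDiffAt ℝ ∞ (fun q : ℝ × ℝ × ℝ => rotModulus α q.2.2) (τ, x, rotAction α k) ∧
    ContDiffAt ℝ ∞ (fun q : ℝ × ℝ × ℝ => ellK (rotModulus α q.2.2)) (τ, x, rotAction α k) := by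
  have hm : ContDiffAt ℝ ∞ (fun q : ℝ × ℝ × ℝ => rotModulus α q.2.2) (τ, x, rotAction α k) :=
    ContDiffAt.comp (τ, x, rotAction α k) (g := rotModulus α) (f := fun q => q.2.2)
      (contDiffAt_rotModulus hα hk) (by fun_prop)
  have hK : ContDiffAt ℝ ∞ (fun q : ℝ × ℝ × ℝ => ellK (rotModulus α q.2.2))
      (τ, x, rotAction α k) := by
    refine ContDiffAt.comp (τ, x, rotAction α k) (g := ellK) ?_ hm
    simp only [rotModulus_rotAction hα hk]
    exact contDiffAt_ellK hk
  exact ⟨((hK.div_const _).mul (by fun_prop)).prodMk hm, hm, hK⟩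

lemma contDiffAt_comp_angle (hα : 0 < α) (hk : k ∈ Ioo (0 : ℝ) 1) (τ x : ℝ) {f : ℝ → ℝ → ℝ}
    (hf : ContDiffOn ℝ ∞ (fun p : ℝ × ℝ => f p.1 p.2) (univ ×ˢ moduli)) :
    ContDiffAt ℝ ∞ (fun q : ℝ × ℝ × ℝ =>
      f (ellK (rotModulus α q.2.2) / π * q.2.1) (rotModulus α q.2.2)) (τ, x, rotAction α k) := by
  refine ContDiffAt.comp (τ, x, rotAction α k) (g := fun p : ℝ × ℝ => f p.1 p.2) ?_
    (contDiffAt_angle hα hk τ x).1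
  refine hf.contDiffAt ((isOpen_univ.prod isOpen_moduli).mem_nhds ⟨mem_univ _, ?_⟩)
  simp only [rotModulus_rotAction hα hk]
  exact sq_lt_one_of_mem hk

lemma contDiffAt_fieldI (hα : 0 < α) (hk : k ∈ Ioo (0 : ℝ) 1) (τ x : ℝ) :
    ContDiffAt ℝ ∞ (fun q : ℝ × ℝ × ℝ => fieldI α C₁ τ₀ q.1 q.2.1 q.2.2)
      (τ, x, rotAction α k) := by
  obtain ⟨-, hm, hK⟩ := contDiffAt_angle hα hk τ x
  have hsn := contDiffAt_comp_angle hα hk τ x contDiffOn_sn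
  have hcn := contDiffAt_comp_angle hα hk τ x contDiffOn_cn
  have hdn := contDiffAt_comp_angle hα hk τ x contDiffOn_dn
  have hcos : ContDiffAt ℝ ∞ (fun q : ℝ × ℝ × ℝ => cos (q.1 - τ₀)) (τ, x, rotAction α k) := by
    fun_prop
  refine ((((contDiffAt_const.mul hK).div_const _).mul hcos).mul ((hsn.mul hcn).mul hdn)).sub
    (((contDiffAt_const.mul hK).div (contDiffAt_const.mul hm) ?_).mul (hdn.pow 2))
  simp only [rotModulus_rotAction hα hk]
  exact mul_ne_zero pi_ne_zero hk.1.ne'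

lemma contDiffAt_fieldPhi (hα : 0 < α) (hk : k ∈ Ioo (0 : ℝ) 1) (τ x : ℝ) :
    ContDiffAt ℝ ∞ (fun q : ℝ × ℝ × ℝ => fieldPhi α C₁ τ₀ q.1 q.2.1 q.2.2)
      (τ, x, rotAction α k) := by
  obtain ⟨-, hm, hK⟩ := contDiffAt_angle hα hk τ x
  have hsn := contDiffAt_comp_angle hα hk τ x contDiffOn_sn
  have hcn := contDiffAt_comp_angle hα hk τ x contDiffOn_cn
  have hdn := contDiffAt_comp_angle hα hk τ x contDiffOn_dn
  have hZ := contDiffAt_comp_angle hα hk τ x contDiffOn_ellZ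
  have hcos : ContDiffAt ℝ ∞ (fun q : ℝ × ℝ × ℝ => cos (q.1 - τ₀)) (τ, x, rotAction α k) := by
    fun_prop
  have hK0 := (ellK_pos (sq_lt_one_of_mem hk)).ne'
  have h1 : ContDiffAt ℝ ∞ (fun q : ℝ × ℝ × ℝ => 1 - rotModulus α q.2.2 ^ 2)
    (τ, x, rotAction α k) := contDiffAt_const.sub (hm.pow 2)
  have h1' : 1 - rotModulus α (rotAction α k) ^ 2 ≠ 0 := by
    rw [rotModulus_rotAction hα hk]; linarith [sq_lt_one_of_mem hk]
  refine ((((contDiffAt_const.mul hm).div (contDiffAt_const.mul hK) ?_).mul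
    (((((hm.pow 2).mul (hsn.pow 2)).mul (hcn.pow 2)).div h1 h1').sub
      ((((hZ.mul hsn).mul hcn).mul hdn).div h1 h1'))).mul hcos).sub
    ((contDiffAt_const.div hK ?_).mul
      (((((hm.pow 2).mul hsn).mul hcn).mul hdn |>.div h1 h1').sub
        ((hZ.mul (hdn.pow 2)).div h1 h1')))
  · simp only [rotModulus_rotAction hα hk]
    exact mul_ne_zero (sqrt_pos.2 hα).ne' hK0
  · simpa only [rotModulus_rotAction hα hk] using hK0

lemma angle_add_two_pi {l : ℝ} (x : ℝ) :
    ellK l / π * (x + 2 * π) = ellK l / π * x + 2 * ellK l := by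
  field_simp

lemma fieldI_add_two_pi {J : ℝ} (hJ : rotModulus α J ∈ Ioo (0 : ℝ) 1) (τ x : ℝ) :
    fieldI α C₁ τ₀ τ (x + 2 * π) J = fieldI α C₁ τ₀ τ x J := by
  have h := sq_lt_one_of_mem hJ
  simp only [fieldI, angle_add_two_pi, sn_add h, cn_add h, dn_add h]
  ring

lemma fieldPhi_add_two_pi {J : ℝ} (hJ : rotModulus α J ∈ Ioo (0 : ℝ) 1) (τ x : ℝ) :
    fieldPhi α C₁ τ₀ τ (x + 2 * π) J = fieldPhi α C₁ τ₀ τ x J := by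
  have h := sq_lt_one_of_mem hJ
  simp only [fieldPhi, angle_add_two_pi, sn_add h, cn_add h, dn_add h, ellZ_add h]
  ring

/-- The perturbation is periodic along the unperturbed flow. -/
lemma field_add {J : ℝ} (hJ : rotModulus α J ∈ Ioo (0 : ℝ) 1) (p q : ℕ) (τ x : ℝ) :
    fieldI α C₁ τ₀ (τ + 2 * π * q) (x + p * (2 * π)) J = fieldI α C₁ τ₀ τ x J ∧
    fieldPhi α C₁ τ₀ (τ + 2 * π * q) (x + p * (2 * π)) J = fieldPhi α C₁ τ₀ τ x J := by
  have hI : Function.Periodic (fun x => fieldI α C₁ τ₀ (τ + 2 * π * q) x J) (2 * π) :=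
    fun x => fieldI_add_two_pi hJ _ x
  have hP : Function.Periodic (fun x => fieldPhi α C₁ τ₀ (τ + 2 * π * q) x J) (2 * π) :=
    fun x => fieldPhi_add_two_pi hJ _ x
  have hc : cos (τ + 2 * π * q - τ₀) = cos (τ - τ₀) := by
    rw [show τ + 2 * π * q - τ₀ = τ - τ₀ + q * (2 * π) by ring, cos_add_nat_mul_two_pi]
  refine ⟨(hI.nat_mul p x).trans ?_, (hP.nat_mul p x).trans ?_⟩
  · simp only [fieldI, hc]
  · simp only [fieldPhi, hc]

end Fields

end Pendulum

/-! ### Fourier coefficients of dn, by continuation to a complex strip -/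

namespace Pendulum

open scoped Topology
open MeasureTheory

/-- Differentiation under the integral sign over a compact interval. -/
lemma hasDerivAt_integral_of_continuousOn {f f' : ℝ → ℝ → ℝ} {S : Set ℝ} (hS : IsOpen S)
    (hf : ∀ x ∈ S, Continuous (f x)) (hf' : ContinuousOn (fun q : ℝ × ℝ => f' q.1 q.2) (S ×ˢ univ))
    (hd : ∀ x ∈ S, ∀ u, HasDerivAt (fun y => f y u) (f' x u) x) (a b : ℝ) {x : ℝ} (hx : x ∈ S) :
    HasDerivAt (fun y => ∫ u in a..b, f y u) (∫ u in a..b, f' x u) x := by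
  obtain ⟨r, hr, hrS⟩ := Metric.nhds_basis_closedBall.mem_iff.1 (hS.mem_nhds hx)
  obtain ⟨C, hC⟩ := ((isCompact_closedBall x r).prod (isCompact_uIcc (a := a) (b := b)))
    |>.exists_bound_of_continuousOn (hf'.mono (prod_mono hrS (subset_univ _)))
  refine (intervalIntegral.hasDerivAt_integral_of_dominated_loc_of_deriv_le
    (F := f) (F' := f') (bound := fun _ => C) (Metric.closedBall_mem_nhds x hr)
    ?_ ?_ ?_ ?_ (by simp) ?_).2
  · filter_upwards [hS.mem_nhds hx] with y hy using (hf y hy).aestronglyMeasurable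
  · exact (hf x hx).intervalIntegrable _ _
  · exact (continuousOn_slice hf' hx).aestronglyMeasurable
  · exact Filter.Eventually.of_forall fun t ht y hy =>
      hC (y, t) ⟨hy, uIoc_subset_uIcc ht⟩
  · exact Filter.Eventually.of_forall fun t _ y hy => hd y (hrS hy) t

section Strip

variable (k : ℝ)

/-- `1 - dn²(u, k) sn²(v, k')` with `x = am(v, k')`. -/
noncomputable def stripDen (x u : ℝ) : ℝ := 1 - dn u k ^ 2 * sin x ^ 2

/-- The real part of `dn(u + iv, k)`, with `x = am(v, k')` and `k' = √(1 - k²)`. -/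
noncomputable def stripRe (x u : ℝ) : ℝ :=
  dn u k * cos x * delta √(1 - k ^ 2) x / stripDen k x u

/-- The imaginary part of `dn(u + iv, k)`, with `x = am(v, k')` and `k' = √(1 - k²)`. -/
noncomputable def stripIm (x u : ℝ) : ℝ :=
  -(k ^ 2 * sn u k * cn u k * sin x) / stripDen k x u

/-- The partial derivative of `stripRe` with respect to `u`. -/
noncomputable def stripReDeriv (x u : ℝ) : ℝ :=
  -(k ^ 2 * sn u k * cn u k * cos x * delta √(1 - k ^ 2) x * (1 + dn u k ^ 2 * sin x ^ 2)) /
    stripDen k x u ^ 2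

/-- The partial derivative of `stripIm` with respect to `u`. -/
noncomputable def stripImDeriv (x u : ℝ) : ℝ :=
  -(k ^ 2 * sin x * dn u k * ((cn u k ^ 2 - sn u k ^ 2) * stripDen k x u
    - 2 * k ^ 2 * sn u k ^ 2 * cn u k ^ 2 * sin x ^ 2)) / stripDen k x u ^ 2

variable {k}

lemma dn_le_one (u : ℝ) : dn u k ≤ 1 := delta_le_one _ _

lemma sin_sq_lt_one {x : ℝ} (hx : x ∈ Ioo (-(π / 2)) (π / 2)) : sin x ^ 2 < 1 := by
  have := cos_pos_of_mem_Ioo hx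
  nlinarith [sin_sq_add_cos_sq x]

lemma stripDen_pos (hk : k ^ 2 < 1) {x : ℝ} (hx : x ∈ Ioo (-(π / 2)) (π / 2)) (u : ℝ) :
    0 < stripDen k x u := by
  have h1 := sin_sq_lt_one hx
  have h2 := dn_le_one (k := k) u
  have h3 := dn_pos hk u
  have : dn u k ^ 2 ≤ 1 := by nlinarith
  unfold stripDen
  nlinarith [sq_nonneg (sin x)]

lemma compl_sq (hk : k ^ 2 < 1) : √(1 - k ^ 2) ^ 2 = 1 - k ^ 2 := sq_sqrt (by linarith)

lemma hasDerivAt_stripDen_snd (hk : k ^ 2 < 1) (x u : ℝ) :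
    HasDerivAt (stripDen k x) (2 * k ^ 2 * dn u k * sn u k * cn u k * sin x ^ 2) u := by
  refine ((((hasDerivAt_dn hk u).pow 2).mul_const (sin x ^ 2)).const_sub 1).congr_deriv ?_
  ring

lemma hasDerivAt_stripDen_fst (x u : ℝ) :
    HasDerivAt (fun x => stripDen k x u) (-(2 * dn u k ^ 2 * sin x * cos x)) x := by
  refine ((((hasDerivAt_sin x).pow 2).const_mul (dn u k ^ 2)).const_sub 1).congr_deriv ?_
  ring

variable {x : ℝ}

lemma hasDerivAt_stripRe_snd (hk : k ^ 2 < 1) (hx : x ∈ Ioo (-(π / 2)) (π / 2)) (u : ℝ) :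
    HasDerivAt (stripRe k x) (stripReDeriv k x u) u := by
  have hN := (stripDen_pos hk hx u).ne'
  refine ((((hasDerivAt_dn hk u).mul_const (cos x)).mul_const (delta √(1 - k ^ 2) x)).div
    (hasDerivAt_stripDen_snd hk x u) hN).congr_deriv ?_
  unfold stripReDeriv
  congr 1
  unfold stripDen
  ring

lemma hasDerivAt_stripIm_snd (hk : k ^ 2 < 1) (hx : x ∈ Ioo (-(π / 2)) (π / 2)) (u : ℝ) :
    HasDerivAt (stripIm k x) (stripImDeriv k x u) u := by
  have hN := (stripDen_pos hk hx u).ne'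
  refine ((((((hasDerivAt_sn hk u).const_mul (k ^ 2)).mul (hasDerivAt_cn hk u)).mul_const
    (sin x)).neg).div (hasDerivAt_stripDen_snd hk x u) hN).congr_deriv ?_
  unfold stripImDeriv
  congr 1
  simp only [Pi.neg_apply, Pi.mul_apply]
  ring

/-- A Cauchy–Riemann equation for dn(u + iv), checked by real algebra. The factor 1 / `delta` is
dv/dx, as x is the amplitude of v for the complementary modulus; k ≠ 0 keeps that modulus below 1.
-/
lemma hasDerivAt_stripRe_fst (hk0 : k ≠ 0) (hk : k ^ 2 < 1) (hx : x ∈ Ioo (-(π / 2)) (π / 2))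
    (u : ℝ) :
    HasDerivAt (fun x => stripRe k x u) (-stripImDeriv k x u / delta √(1 - k ^ 2) x) x := by
  have hN := (stripDen_pos hk hx u).ne'
  have hk' : √(1 - k ^ 2) ^ 2 < 1 := by rw [compl_sq hk]; nlinarith [sq_pos_of_ne_zero hk0]
  have hD := (delta_pos hk' x).ne'
  refine ((((hasDerivAt_cos x).const_mul (dn u k)).mul (hasDerivAt_delta hk' x)).div
    (hasDerivAt_stripDen_fst x u) hN).congr_deriv ?_
  unfold stripImDeriv
  have e1 := delta_sq hk' x
  have e2 := dn_sq hk u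
  have e3 := cn_sq u k
  have e4 := cos_sq' x
  rw [compl_sq hk] at e1 ⊢
  -- The Cauchy–Riemann identity cleared of denominators: both sides become polynomials in k², sn²
  -- and sin² x.
  have key : (-delta √(1 - k ^ 2) x ^ 2 - (1 - k ^ 2) * cos x ^ 2) * (1 - dn u k ^ 2 * sin x ^ 2)
      + 2 * dn u k ^ 2 * cos x ^ 2 * delta √(1 - k ^ 2) x ^ 2 =
      k ^ 2 * ((cn u k ^ 2 - sn u k ^ 2) * (1 - dn u k ^ 2 * sin x ^ 2)
        - 2 * k ^ 2 * sn u k ^ 2 * cn u k ^ 2 * sin x ^ 2) := by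
    rw [e1, e2, e3, e4]; ring
  simp only [Pi.mul_apply]
  field_simp
  unfold stripDen
  linear_combination (dn u k * sin x) * key

lemma hasDerivAt_stripIm_fst (hk0 : k ≠ 0) (hk : k ^ 2 < 1) (hx : x ∈ Ioo (-(π / 2)) (π / 2))
    (u : ℝ) :
    HasDerivAt (fun x => stripIm k x u) (stripReDeriv k x u / delta √(1 - k ^ 2) x) x := by
  have hN := (stripDen_pos hk hx u).ne'
  have hk' : √(1 - k ^ 2) ^ 2 < 1 := by rw [compl_sq hk]; nlinarith [sq_pos_of_ne_zero hk0]
  have hD := (delta_pos hk' x).ne'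
  refine ((((hasDerivAt_sin x).const_mul (k ^ 2 * sn u k * cn u k)).neg).div
    (hasDerivAt_stripDen_fst x u) hN).congr_deriv ?_
  unfold stripReDeriv
  simp only [Pi.neg_apply]
  field_simp
  unfold stripDen
  ring

variable (k) in
/-- The cosine coefficient of `stripRe`. -/
noncomputable def stripReCoeff (l x : ℝ) : ℝ :=
  ∫ u in (-ellK k)..(ellK k), stripRe k x u * cos (l * u)

variable (k) in
/-- The sine coefficient of `stripIm`. -/
noncomputable def stripImCoeff (l x : ℝ) : ℝ :=
  ∫ u in (-ellK k)..(ellK k), stripIm k x u * sin (l * u)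

lemma continuousOn_strip (hk : k ^ 2 < 1) :
    ContinuousOn (fun q : ℝ × ℝ => stripReDeriv k q.1 q.2) (Ioo (-(π / 2)) (π / 2) ×ˢ univ) ∧
    ContinuousOn (fun q : ℝ × ℝ => stripImDeriv k q.1 q.2) (Ioo (-(π / 2)) (π / 2) ×ˢ univ) := by
  have h1 : Continuous fun q : ℝ × ℝ => sn q.2 k := (continuous_sn hk).comp continuous_snd
  have h2 : Continuous fun q : ℝ × ℝ => cn q.2 k := (continuous_cn hk).comp continuous_snd
  have h3 : Continuous fun q : ℝ × ℝ => dn q.2 k := (continuous_dn hk).comp continuous_snd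
  have h4 : Continuous fun q : ℝ × ℝ => delta √(1 - k ^ 2) q.1 :=
    (continuous_delta _).comp continuous_fst
  have h5 : Continuous fun q : ℝ × ℝ => stripDen k q.1 q.2 := by unfold stripDen; fun_prop
  unfold stripReDeriv stripImDeriv
  exact ⟨ContinuousOn.div (by fun_prop) (by fun_prop)
      fun q hq => pow_ne_zero 2 (stripDen_pos hk hq.1 q.2).ne',
    ContinuousOn.div (by fun_prop) (by fun_prop)
      fun q hq => pow_ne_zero 2 (stripDen_pos hk hq.1 q.2).ne'⟩

lemma continuous_stripRe (hk : k ^ 2 < 1) (hx : x ∈ Ioo (-(π / 2)) (π / 2)) :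
    Continuous (stripRe k x) :=
  continuous_iff_continuousAt.2 fun u => (hasDerivAt_stripRe_snd hk hx u).continuousAt

lemma continuous_stripIm (hk : k ^ 2 < 1) (hx : x ∈ Ioo (-(π / 2)) (π / 2)) :
    Continuous (stripIm k x) :=
  continuous_iff_continuousAt.2 fun u => (hasDerivAt_stripIm_snd hk hx u).continuousAt

lemma cn_ellK (hk : k ^ 2 < 1) : cn (ellK k) k = 0 := by rw [cn, am_ellK hk, cos_pi_div_two]

lemma continuous_stripImDeriv (hk : k ^ 2 < 1) (hx : x ∈ Ioo (-(π / 2)) (π / 2)) :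
    Continuous (stripImDeriv k x) := continuousOn_slice (continuousOn_strip hk).2 hx

lemma continuous_stripReDeriv (hk : k ^ 2 < 1) (hx : x ∈ Ioo (-(π / 2)) (π / 2)) :
    Continuous (stripReDeriv k x) := continuousOn_slice (continuousOn_strip hk).1 hx

/-- Integration by parts; the boundary terms vanish for every l because cn vanishes at ±K. -/
lemma integral_stripImDeriv (hk : k ^ 2 < 1) (hx : x ∈ Ioo (-(π / 2)) (π / 2)) (l : ℝ) :
    ∫ u in (-ellK k)..(ellK k), stripImDeriv k x u * cos (l * u) = l * stripImCoeff k l x := by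
  have h := intervalIntegral.integral_mul_deriv_eq_deriv_mul (a := -ellK k) (b := ellK k)
    (u := fun u => cos (l * u)) (u' := fun u => -(l * sin (l * u)))
    (v := stripIm k x) (v' := stripImDeriv k x)
    (fun u _ => ((hasDerivAt_id u).const_mul l).cos.congr_deriv (by simp; ring))
    (fun u _ => hasDerivAt_stripIm_snd hk hx u)
    (Continuous.intervalIntegrable (by fun_prop) _ _)
    ((continuous_stripImDeriv hk hx).intervalIntegrable _ _)
  have h0 : stripIm k x (ellK k) = 0 := by simp [stripIm, cn_ellK hk]
  have h0' : stripIm k x (-ellK k) = 0 := by simp [stripIm, cn_neg hk, cn_ellK hk]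
  rw [h0, h0'] at h
  simp only [mul_comm (stripImDeriv k x _)]
  rw [h, stripImCoeff, ← intervalIntegral.integral_const_mul, mul_zero, mul_zero, sub_zero,
    zero_sub, ← intervalIntegral.integral_neg]
  congr 1; ext u; ring

/-- Here the boundary terms contain sin(lK), so l must be a frequency compatible with the period 2K.
-/
lemma integral_stripReDeriv (hk : k ^ 2 < 1) (hx : x ∈ Ioo (-(π / 2)) (π / 2)) {l : ℝ}
    (hl : sin (l * ellK k) = 0) :
    ∫ u in (-ellK k)..(ellK k), stripReDeriv k x u * sin (l * u) = -(l * stripReCoeff k l x) := by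
  have h := intervalIntegral.integral_mul_deriv_eq_deriv_mul (a := -ellK k) (b := ellK k)
    (u := fun u => sin (l * u)) (u' := fun u => l * cos (l * u))
    (v := stripRe k x) (v' := stripReDeriv k x)
    (fun u _ => ((hasDerivAt_id u).const_mul l).sin.congr_deriv (by simp; ring))
    (fun u _ => hasDerivAt_stripRe_snd hk hx u)
    (Continuous.intervalIntegrable (by fun_prop) _ _)
    ((continuous_stripReDeriv hk hx).intervalIntegrable _ _)
  simp only [mul_neg, sin_neg, hl, neg_zero, zero_mul, sub_zero] at h
  simp only [mul_comm (stripReDeriv k x _)]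
  rw [h, stripReCoeff, ← intervalIntegral.integral_const_mul, zero_sub]
  congr 2; ext u; ring

lemma hasDerivAt_stripReCoeff (hk0 : k ≠ 0) (hk : k ^ 2 < 1) (hx : x ∈ Ioo (-(π / 2)) (π / 2))
    (l : ℝ) :
    HasDerivAt (stripReCoeff k l) (-(l * stripImCoeff k l x) / delta √(1 - k ^ 2) x) x := by
  have hk' : √(1 - k ^ 2) ^ 2 < 1 := by rw [compl_sq hk]; nlinarith [sq_pos_of_ne_zero hk0]
  have h := hasDerivAt_integral_of_continuousOn (f := fun x u => stripRe k x u * cos (l * u))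
    (f' := fun x u => -stripImDeriv k x u / delta √(1 - k ^ 2) x * cos (l * u)) isOpen_Ioo
    (fun y hy => (continuous_stripRe hk hy).mul (by fun_prop)) ?_
    (fun y hy u => (hasDerivAt_stripRe_fst hk0 hk hy u).mul_const _) (-ellK k) (ellK k) hx
  · refine h.congr_deriv ?_
    rw [← integral_stripImDeriv hk hx, ← intervalIntegral.integral_neg,
      ← intervalIntegral.integral_div]
    congr 1; ext u; ring
  · exact (ContinuousOn.div (continuousOn_strip hk).2.neg
      ((continuous_delta _).comp continuous_fst).continuousOn
      fun q _ => (delta_pos hk' q.1).ne').mul (by fun_prop)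

lemma hasDerivAt_stripImCoeff (hk0 : k ≠ 0) (hk : k ^ 2 < 1) (hx : x ∈ Ioo (-(π / 2)) (π / 2))
    {l : ℝ} (hl : sin (l * ellK k) = 0) :
    HasDerivAt (stripImCoeff k l) (-(l * stripReCoeff k l x) / delta √(1 - k ^ 2) x) x := by
  have hk' : √(1 - k ^ 2) ^ 2 < 1 := by rw [compl_sq hk]; nlinarith [sq_pos_of_ne_zero hk0]
  have h := hasDerivAt_integral_of_continuousOn (f := fun x u => stripIm k x u * sin (l * u))
    (f' := fun x u => stripReDeriv k x u / delta √(1 - k ^ 2) x * sin (l * u)) isOpen_Ioo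
    (fun y hy => (continuous_stripIm hk hy).mul (by fun_prop)) ?_
    (fun y hy u => (hasDerivAt_stripIm_fst hk0 hk hy u).mul_const _) (-ellK k) (ellK k) hx
  · refine h.congr_deriv ?_
    rw [← integral_stripReDeriv hk hx hl, ← intervalIntegral.integral_div]
    congr 1; ext u; ring
  · exact (ContinuousOn.div (continuousOn_strip hk).1
      ((continuous_delta _).comp continuous_fst).continuousOn
      fun q _ => (delta_pos hk' q.1).ne').mul (by fun_prop)

/-- The cosine coefficients of `Re dn(u + iv)` are those of `dn u` times `cosh (l v)`. -/
lemma stripReCoeff_eq (hk0 : k ≠ 0) (hk : k ^ 2 < 1) (hx : x ∈ Ioo (-(π / 2)) (π / 2))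
    {l : ℝ} (hl : sin (l * ellK k) = 0) :
    stripReCoeff k l x =
      (∫ u in (-ellK k)..(ellK k), dn u k * cos (l * u)) * cosh (l * ellF √(1 - k ^ 2) x) := by
  have hk' : √(1 - k ^ 2) ^ 2 < 1 := by rw [compl_sq hk]; nlinarith [sq_pos_of_ne_zero hk0]
  have h0 : (0 : ℝ) ∈ Ioo (-(π / 2)) (π / 2) := ⟨by linarith [pi_pos], by linarith [pi_pos]⟩
  set L : ℝ → ℝ := fun y => l * ellF √(1 - k ^ 2) y with hL
  have hLd (y : ℝ) : HasDerivAt L (l * (1 / delta √(1 - k ^ 2) y)) y :=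
    (hasDerivAt_ellF hk' y).const_mul l
  have hL0 : L 0 = 0 := by simp [hL]
  have hconst {f : ℝ → ℝ} (hf : ∀ y ∈ Ioo (-(π / 2)) (π / 2), HasDerivAt f 0 y) : f x = f 0 :=
    isOpen_Ioo.is_const_of_deriv_eq_zero isPreconnected_Ioo
      (fun y hy => (hf y hy).differentiableAt.differentiableWithinAt)
      (fun y hy => (hf y hy).deriv) hx h0
  -- With respect to v the two coefficients satisfy R' = -l M, M' = -l R. The combinations below are
  -- the conserved quantities of this linear system; at x = 0 they equal the coefficient of dn and
  -- 0, and cosh² - sinh² = 1 then recovers R.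
  have hX := hconst
    (f := fun y => stripReCoeff k l y * cosh (L y) + stripImCoeff k l y * sinh (L y))
    fun y hy => by
      refine (((hasDerivAt_stripReCoeff hk0 hk hy l).mul (hLd y).cosh).add
        ((hasDerivAt_stripImCoeff hk0 hk hy hl).mul (hLd y).sinh)).congr_deriv ?_
      ring
  have hY := hconst
    (f := fun y => stripReCoeff k l y * sinh (L y) + stripImCoeff k l y * cosh (L y))
    fun y hy => by
      refine (((hasDerivAt_stripReCoeff hk0 hk hy l).mul (hLd y).sinh).add
        ((hasDerivAt_stripImCoeff hk0 hk hy hl).mul (hLd y).cosh)).congr_deriv ?_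
      ring
  have hI0 : stripImCoeff k l 0 = 0 := by simp [stripImCoeff, stripIm]
  have hR0 : stripReCoeff k l 0 = ∫ u in (-ellK k)..(ellK k), dn u k * cos (l * u) := by
    simp [stripReCoeff, stripRe, stripDen, delta]
  simp only [hL0, hI0, hR0, cosh_zero, sinh_zero, mul_one, mul_zero, add_zero] at hX hY
  have hcs := cosh_sq (L x)
  change _ = _ * cosh (L x)
  linear_combination cosh (L x) * hX - sinh (L x) * hY - stripReCoeff k l x * hcs

lemma stripRe_nonneg (hk : k ^ 2 < 1) (hx : x ∈ Ioo (-(π / 2)) (π / 2)) (u : ℝ) :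
    0 ≤ stripRe k x u :=
  div_nonneg (mul_nonneg (mul_nonneg (dn_pos hk u).le (cos_pos_of_mem_Ioo hx).le)
    (sqrt_nonneg _)) (stripDen_pos hk hx u).le

/-- For |u| ≤ K the amplitude lies in [-π/2, π/2], where |sin| grows with the modulus of its
argument. This bounds 1 - dn² from below away from u = 0. -/
lemma sn_sq_ge (hk : k ^ 2 < 1) {a u : ℝ} (ha : 0 ≤ a) (hau : a ≤ |u|) (hu : |u| ≤ ellK k) :
    sn a k ^ 2 ≤ sn u k ^ 2 := by
  have h1 : sn u k ^ 2 = sn |u| k ^ 2 := by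
    rcases abs_cases u with h | h <;> simp [h.1, sn_neg hk]
  have hm := (strictMono_am hk).monotone
  have h2 : (0 : ℝ) ≤ am a k := by have := hm ha; simpa [am_zero hk] using this
  have h3 : am a k ≤ am |u| k := hm hau
  have h4 : am |u| k ≤ π / 2 := by have := hm hu; simpa [am_ellK hk] using this
  rw [h1]
  refine pow_le_pow_left₀ (sin_nonneg_of_nonneg_of_le_pi h2 (by linarith [pi_pos])) ?_ 2
  exact sin_le_sin_of_le_of_le_pi_div_two (by linarith [pi_pos]) h4 h3

lemma sn_pos (hk : k ^ 2 < 1) {a : ℝ} (ha : 0 < a) (haK : a ≤ ellK k) : 0 < sn a k := by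
  have h2 : (0 : ℝ) < am a k := by have := strictMono_am hk ha; simpa [am_zero hk] using this
  have h4 : am a k ≤ π / 2 := by
    have := (strictMono_am hk).monotone haK; simpa [am_ellK hk] using this
  exact sin_pos_of_pos_of_lt_pi h2 (by linarith [pi_pos])

/-- The Fourier coefficients of `dn` are positive. -/
theorem integral_dn_mul_cos_pos (hk0 : k ≠ 0) (hk : k ^ 2 < 1) {l : ℝ} (hl0 : 0 ≤ l)
    (hl : sin (l * ellK k) = 0) :
    0 < ∫ u in (-ellK k)..(ellK k), dn u k * cos (l * u) := by
  have hK := ellK_pos hk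
  have hA0 : 0 < ∫ u in (-ellK k)..(ellK k), dn u k :=
    intervalIntegral.intervalIntegral_pos_of_pos ((continuous_dn hk).intervalIntegrable _ _)
      (dn_pos hk) (by linarith)
  -- η bounds the denominator `stripDen` from below outside the central zone |lu| ≤ 1. If lK ≤ 1
  -- there is no outside and 1 will do; otherwise 1 - dn² = k² sn² is at least its value at u = 1/l.
  obtain ⟨η, hη, hout⟩ : ∃ η > 0, ∀ u, |u| ≤ ellK k → 1 < |l * u| → η ≤ 1 - dn u k ^ 2 := by
    rcases le_or_gt (l * ellK k) 1 with h | h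
    · refine ⟨1, one_pos, fun u hu h1 => absurd h1 (not_lt.2 ?_)⟩
      rw [abs_mul, abs_of_nonneg hl0]
      exact (mul_le_mul_of_nonneg_left hu hl0).trans h
    · have hl1 : 0 < l := by
        rcases hl0.eq_or_lt with rfl | h1
        · norm_num at h
        · exact h1
      have ha : 1 / l ≤ ellK k := by rw [div_le_iff₀ hl1]; linarith
      have hs := sn_pos hk (one_div_pos.2 hl1) ha
      refine ⟨k ^ 2 * sn (1 / l) k ^ 2, by positivity, fun u hu h1 => ?_⟩
      rw [dn_sq hk, sub_sub_cancel]
      refine mul_le_mul_of_nonneg_left (sn_sq_ge hk (by positivity) ?_ hu) (sq_nonneg k)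
      rw [abs_mul, abs_of_nonneg hl0] at h1
      rw [div_le_iff₀ hl1]; linarith
  set A₀ := ∫ u in (-ellK k)..(ellK k), dn u k
  -- c will be cos x, which tends to 0 as v tends to K'. It is taken so small that the kernel
  -- outside the central zone cannot spoil half of the mass A₀.
  obtain ⟨c, hc0, hc1, hc⟩ : ∃ c : ℝ, 0 < c ∧ c ≤ 1 ∧ 3 / 2 * (c / η) * (2 * ellK k) < A₀ / 2 := by
    refine ⟨min 1 (A₀ * η / (12 * ellK k)), by positivity, min_le_left _ _, ?_⟩
    have h1 := min_le_right 1 (A₀ * η / (12 * ellK k))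
    set c := min 1 (A₀ * η / (12 * ellK k))
    rw [le_div_iff₀ (by positivity)] at h1
    have : 3 / 2 * (c / η) * (2 * ellK k) = 3 * ellK k * c / η := by ring
    rw [this, div_lt_iff₀ hη]
    nlinarith [mul_pos hA0 hη]
  set x := arccos c
  have hx : x ∈ Ioo (-(π / 2)) (π / 2) :=
    ⟨by linarith [arccos_nonneg c, pi_pos], arccos_lt_pi_div_two.2 hc0⟩
  have hcos : cos x = c := cos_arccos (by linarith) hc1
  -- The case l = 0: the factor cosh is 1, so the mass does not depend on x.
  have hmass : ∫ u in (-ellK k)..(ellK k), stripRe k x u = A₀ := by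
    have := stripReCoeff_eq hk0 hk hx (l := 0) (by simp)
    simpa [stripReCoeff] using this
  -- In the central zone cos(lu) ≥ 1/2. Outside, cos(lu) ≥ -1 and the kernel is at most c/η, so its
  -- negative is at least half of it minus 3c/(2η).
  have hpt (u : ℝ) (hu : u ∈ Icc (-ellK k) (ellK k)) :
      stripRe k x u / 2 - 3 / 2 * (c / η) ≤ stripRe k x u * cos (l * u) := by
    have hP := stripRe_nonneg hk hx u
    rcases le_or_gt |l * u| 1 with h | h
    · have h1 : 1 / 2 ≤ cos (l * u) := by
        have := one_sub_sq_div_two_le_cos (x := l * u)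
        nlinarith [(sq_le_one_iff_abs_le_one (l * u)).2 h]
      have : 0 < c / η := by positivity
      nlinarith
    · have h1 := hout u (abs_le.2 hu) h
      have h2 : stripRe k x u ≤ c / η := by
        refine div_le_div₀ hc0.le ?_ hη ?_
        · rw [hcos]
          have h3 := mul_le_one₀ (dn_le_one (k := k) u) (sqrt_nonneg _)
            (delta_le_one √(1 - k ^ 2) x)
          calc dn u k * c * delta √(1 - k ^ 2) x = c * (dn u k * delta √(1 - k ^ 2) x) := by ring
            _ ≤ c * 1 := mul_le_mul_of_nonneg_left h3 hc0.le
            _ = c := mul_one c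
        · unfold stripDen
          nlinarith [sin_sq_le_one x, sq_nonneg (dn u k)]
      nlinarith [neg_one_le_cos (l * u)]
  have hcont := continuous_stripRe hk hx
  have hint := intervalIntegral.integral_mono_on (μ := volume) (by linarith : -ellK k ≤ ellK k)
    (Continuous.intervalIntegrable (by fun_prop) _ _)
    (Continuous.intervalIntegrable (by fun_prop) _ _) hpt
  rw [intervalIntegral.integral_sub (Continuous.intervalIntegrable (by fun_prop) _ _) (by simp),
    intervalIntegral.integral_div, hmass, intervalIntegral.integral_const, smul_eq_mul] at hint
  have hpos : 0 < stripReCoeff k l x := by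
    refine lt_of_lt_of_le ?_ hint
    linarith
  rw [stripReCoeff_eq hk0 hk hx hl] at hpos
  exact pos_of_mul_pos_left hpos (cosh_pos _).le

end Strip

end Pendulum

/-! ### From the coefficients of dn to those of dn² -/

namespace Pendulum

open MeasureTheory

lemma integral_eq_zero_of_odd {f : ℝ → ℝ} (hf : ∀ u, f (-u) = -f u) (a : ℝ) :
    ∫ u in (-a)..a, f u = 0 := by
  have h := intervalIntegral.integral_comp_neg (a := -a) (b := a) f
  simp only [hf, neg_neg, intervalIntegral.integral_neg] at h
  linarith

lemma integral_cexp_mul_of_even {f : ℝ → ℝ} (hc : Continuous f) (he : ∀ u, f (-u) = f u)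
    (a l : ℝ) :
    ∫ u in (-a)..a, Complex.exp (((l * u : ℝ) : ℂ) * Complex.I) * (f u : ℂ) =
      ((∫ u in (-a)..a, f u * cos (l * u) : ℝ) : ℂ) := by
  have h1 (u : ℝ) : Complex.exp (((l * u : ℝ) : ℂ) * Complex.I) * (f u : ℂ) =
      ((f u * cos (l * u) : ℝ) : ℂ) + ((f u * sin (l * u) : ℝ) : ℂ) * Complex.I := by
    rw [Complex.exp_mul_I]; push_cast; ring
  have h2 : ∫ u in (-a)..a, f u * sin (l * u) = 0 :=
    integral_eq_zero_of_odd (fun u => by simp [he]) a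
  simp only [h1]
  rw [intervalIntegral.integral_add (Continuous.intervalIntegrable (by fun_prop) _ _)
    (Continuous.intervalIntegrable (by fun_prop) _ _), intervalIntegral.integral_mul_const,
    intervalIntegral.integral_ofReal, intervalIntegral.integral_ofReal, h2]
  simp

/-- If the Fourier coefficients of an even function are positive, so are those of its square. -/
theorem integral_sq_mul_cos_pos {f : ℝ → ℝ} {K : ℝ} (hK : 0 < K) (hc : Continuous f)
    (he : ∀ u, f (-u) = f u) (hp : Function.Periodic f (2 * K))
    (hpos : ∀ n : ℕ, 0 < ∫ u in (-K)..K, f u * cos (n * π / K * u)) (m : ℕ) :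
    0 < ∫ u in (-K)..K, f u ^ 2 * cos (m * π / K * u) := by
  have : Fact (0 < 2 * K) := ⟨by linarith⟩
  have hpc : Function.Periodic (fun u => (f u : ℂ)) (2 * K) := fun u => by simp [hp u]
  let φ : C(AddCircle (2 * K), ℂ) :=
    ⟨hpc.lift, continuous_coinduced_dom.2 (Complex.continuous_ofReal.comp hc)⟩
  have hφ (u : ℝ) : φ (u : AddCircle (2 * K)) = (f u : ℂ) := rfl
  have hfou (n : ℤ) (u : ℝ) : fourier n (u : AddCircle (2 * K)) =
      Complex.exp (((n * π / K * u : ℝ) : ℂ) * Complex.I) := by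
    rw [fourier_coe_apply]
    have : (K : ℂ) ≠ 0 := by exact_mod_cast hK.ne'
    congr 1; push_cast; field_simp
  have hcos (n : ℤ) (g : ℝ → ℝ) : ∫ u in (-K)..K, g u * cos (n * π / K * u) =
      ∫ u in (-K)..K, g u * cos (n.natAbs * π / K * u) := by
    congr 1; ext u
    rcases Int.natAbs_eq n with h | h
    · conv_lhs => rw [h]
      simp
    · conv_lhs => rw [h]
      simp [neg_mul, neg_div]
  have hcoeff (n : ℤ) : fourierCoeff φ n =
      ((1 / (2 * K) * ∫ u in (-K)..K, f u * cos (n.natAbs * π / K * u) : ℝ) : ℂ) := by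
    rw [fourierCoeff_eq_intervalIntegral φ n (-K), show -K + 2 * K = K by ring]
    simp only [hφ, hfou, smul_eq_mul]
    rw [integral_cexp_mul_of_even hc he, hcos, Int.natAbs_neg]
    push_cast
    rw [Complex.real_smul]; push_cast; rfl
  have hreal (n : ℤ) : 0 < 1 / (2 * K) * ∫ u in (-K)..K, f u * cos (n.natAbs * π / K * u) :=
    mul_pos (by positivity) (hpos _)
  -- Multiplication by a character shifts the coefficients by m, so the inner product of φ with ψ is
  -- the m-th coefficient of f², while Parseval writes it as a sum of products of positive numbers.
  let ψ : C(AddCircle (2 * K), ℂ) := fourier (-(m : ℤ)) * φ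
  have hψ (n : ℤ) : fourierCoeff ψ n = fourierCoeff φ (n + m) := by
    unfold fourierCoeff
    congr 1; ext t
    simp only [ψ, ContinuousMap.mul_apply, smul_eq_mul]
    rw [← mul_assoc, ← fourier_add, neg_add]
  have hsum := (fourierBasis (T := 2 * K)).hasSum_inner_mul_inner
    (ContinuousMap.toLp 2 AddCircle.haarAddCircle ℂ φ)
    (ContinuousMap.toLp 2 AddCircle.haarAddCircle ℂ ψ)
  have hterm (n : ℤ) : inner ℂ (ContinuousMap.toLp 2 AddCircle.haarAddCircle ℂ φ)
      (fourierBasis (T := 2 * K) n) * inner ℂ (fourierBasis (T := 2 * K) n)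
        (ContinuousMap.toLp 2 AddCircle.haarAddCircle ℂ ψ) =
      (((1 / (2 * K) * ∫ u in (-K)..K, f u * cos (n.natAbs * π / K * u)) *
        (1 / (2 * K) * ∫ u in (-K)..K, f u * cos ((n + m).natAbs * π / K * u)) : ℝ) : ℂ) := by
    rw [← inner_conj_symm, ← HilbertBasis.repr_apply_apply, ← HilbertBasis.repr_apply_apply,
      fourierBasis_repr, fourierBasis_repr, fourierCoeff_toLp, fourierCoeff_toLp, hψ, hcoeff,
      hcoeff, Complex.conj_ofReal, ← Complex.ofReal_mul]
  have hinner : inner ℂ (ContinuousMap.toLp 2 AddCircle.haarAddCircle ℂ φ)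
      (ContinuousMap.toLp 2 AddCircle.haarAddCircle ℂ ψ) =
      ((1 / (2 * K) * ∫ u in (-K)..K, f u ^ 2 * cos (m * π / K * u) : ℝ) : ℂ) := by
    rw [ContinuousMap.inner_toLp]
    -- f is real, so the conjugate in the inner product disappears and the square of f remains.
    let χ : AddCircle (2 * K) → ℂ := fun t => φ t * φ t
    have h1 : ∫ t, ψ t * (starRingEnd ℂ) (φ t) ∂AddCircle.haarAddCircle = fourierCoeff χ m := by
      unfold fourierCoeff
      congr 1; ext t
      induction t using QuotientAddGroup.induction_on with
      | H u =>
        change fourier (-(m : ℤ)) (u : AddCircle (2 * K)) * φ (u : AddCircle (2 * K)) *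
          (starRingEnd ℂ) (φ (u : AddCircle (2 * K))) = fourier (-(m : ℤ)) (u : AddCircle (2 * K)) •
            (φ (u : AddCircle (2 * K)) * φ (u : AddCircle (2 * K)))
        rw [hφ, Complex.conj_ofReal, smul_eq_mul, mul_assoc]
    rw [h1, fourierCoeff_eq_intervalIntegral χ m (-K), show -K + 2 * K = K by ring]
    have h2 (u : ℝ) : χ (u : AddCircle (2 * K)) = ((f u ^ 2 : ℝ) : ℂ) := by
      simp only [χ, hφ]; push_cast; ring
    simp only [h2, hfou, smul_eq_mul]
    rw [integral_cexp_mul_of_even (f := fun u => f u ^ 2) (hc.pow 2) (fun u => by rw [he]), hcos,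
      Int.natAbs_neg, Int.natAbs_natCast]
    rw [Complex.real_smul]; push_cast; rfl
  simp only [hterm] at hsum
  rw [hinner, Complex.hasSum_ofReal] at hsum
  have h := hsum.tsum_eq ▸ hsum.summable.tsum_pos
    (fun n => (mul_pos (hreal n) (hreal (n + m))).le) 0 (mul_pos (hreal 0) (hreal (0 + m)))
  exact pos_of_mul_pos_right h (by positivity)

/-- The Fourier coefficients of `dn²` are positive. -/
theorem integral_dn_sq_mul_cos_pos {k : ℝ} (hk0 : k ≠ 0) (hk : k ^ 2 < 1) (m : ℕ) :
    0 < ∫ u in (-ellK k)..(ellK k), dn u k ^ 2 * cos (m * π / ellK k * u) := by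
  have hK := ellK_pos hk
  refine integral_sq_mul_cos_pos hK (continuous_dn hk) (dn_neg hk) (dn_add hk) (fun n => ?_) m
  refine integral_dn_mul_cos_pos hk0 hk (by positivity) ?_
  rw [div_mul_cancel₀ _ hK.ne']
  exact sin_nat_mul_pi n

end Pendulum

/-! ### Coefficients of composed formal series -/

namespace Pendulum

open scoped ContDiff Topology
open Filter Asymptotics

section Coefficients

/-- The constant term is the limit at 0, hence zero; division by x lowers the degree. The punctured
neighbourhood permits the division. -/
lemma eq_zero_of_sum_isLittleO {n : ℕ} {a : ℕ → ℝ}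
    (h : (fun x : ℝ => ∑ j ∈ Finset.range (n + 1), a j * x ^ j) =o[𝓝[≠] 0] fun x => x ^ n) :
    ∀ j ≤ n, a j = 0 := by
  induction n generalizing a with
  | zero =>
    intro j hj
    obtain rfl : j = 0 := by omega
    simpa [isLittleO_const_const_iff] using h
  | succ n ih =>
    have hsum (x : ℝ) : ∑ j ∈ Finset.range (n + 1 + 1), a j * x ^ j =
        x * (∑ j ∈ Finset.range (n + 1), a (j + 1) * x ^ j) + a 0 := by
      rw [Finset.sum_range_succ', Finset.mul_sum]
      simp only [pow_zero, mul_one]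
      congr 1
      exact Finset.sum_congr rfl fun j _ => by ring
    have h1 : Tendsto (fun x : ℝ => ∑ j ∈ Finset.range (n + 1 + 1), a j * x ^ j) (𝓝[≠] 0)
        (𝓝 (a 0)) := by
      have hc : Continuous fun x : ℝ => ∑ j ∈ Finset.range (n + 1 + 1), a j * x ^ j := by
        fun_prop
      have := (hc.tendsto 0).mono_left (nhdsWithin_le_nhds (s := {0}ᶜ))
      rw [hsum] at this
      simpa using this
    have h2 : Tendsto (fun x : ℝ => x ^ (n + 1)) (𝓝[≠] 0) (𝓝 0) := by
      have := ((continuous_pow (n + 1)).tendsto (0 : ℝ)).mono_left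
        (nhdsWithin_le_nhds (s := {0}ᶜ))
      simpa using this
    have h0 : a 0 = 0 := tendsto_nhds_unique h1 (h.isBigO.trans_tendsto h2)
    have h3 : (fun x : ℝ => ∑ j ∈ Finset.range (n + 1), a (j + 1) * x ^ j) =o[𝓝[≠] 0]
        fun x => x ^ n := by
      have h4 := (isBigO_refl (fun x : ℝ => x⁻¹) (𝓝[≠] 0)).mul_isLittleO h
      refine h4.congr' ?_ ?_
      · filter_upwards [self_mem_nhdsWithin] with x hx
        have hx0 : x ≠ 0 := hx
        rw [hsum, h0]; field_simp; ring
      · filter_upwards [self_mem_nhdsWithin] with x hx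
        have hx0 : x ≠ 0 := hx
        rw [pow_succ]; field_simp
    intro j hj
    rcases j with _ | j
    · exact h0
    · exact ih h3 j (by omega)

/-- A Peano expansion `f x = c xⁿ + o(xⁿ)` determines the `n`-th derivative at `0`. -/
lemma iteratedDeriv_eq_of_isLittleO {f : ℝ → ℝ} {n : ℕ} {c : ℝ} (hf : ContDiffAt ℝ n f 0)
    (h : (fun x => f x - x ^ n * c) =o[𝓝 0] fun x => x ^ n) :
    iteratedDeriv n f 0 / (n.factorial : ℝ) = c := by
  obtain ⟨u, hu, hfu⟩ := hf.contDiffOn le_rfl (by simp)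
  obtain ⟨r, hr, hru⟩ := Metric.nhds_basis_ball.mem_iff.1
    (by simpa using hu : u ∈ 𝓝 (0 : ℝ))
  have hr0 : (0 : ℝ) ∈ Metric.ball 0 r := Metric.mem_ball_self hr
  have ht := taylor_isLittleO (convex_ball 0 r) hr0 (hfu.mono hru)
  rw [nhdsWithin_eq_nhds.2 (Metric.ball_mem_nhds 0 hr)] at ht
  simp only [sub_zero] at ht
  -- Coefficients of the Taylor polynomial minus c xⁿ. That polynomial is o(xⁿ), so they all vanish,
  -- and the top one is the claim.
  set a : ℕ → ℝ := fun j => iteratedDeriv j f 0 / (j.factorial : ℝ) - if j = n then c else 0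
  have hs : (fun x : ℝ => ∑ j ∈ Finset.range (n + 1), a j * x ^ j) =o[𝓝 0] fun x => x ^ n := by
    refine (h.sub ht).congr_left fun x => ?_
    have h1 : ∑ j ∈ Finset.range (n + 1), a j * x ^ j =
        (∑ j ∈ Finset.range (n + 1), iteratedDeriv j f 0 / (j.factorial : ℝ) * x ^ j)
          - x ^ n * c := by
      simp only [a, sub_mul, Finset.sum_sub_distrib, ite_mul, zero_mul]
      rw [Finset.sum_ite_eq' (Finset.range (n + 1)) n, if_pos (by simp)]
      ring
    rw [h1, taylor_within_apply]
    simp only [iteratedDerivWithin_of_isOpen Metric.isOpen_ball hr0, sub_zero, smul_eq_mul]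
    rw [sub_sub_sub_cancel_left]
    congr 1
    exact Finset.sum_congr rfl fun j _ => by rw [div_eq_inv_mul]; ring
  have := eq_zero_of_sum_isLittleO (hs.mono nhdsWithin_le_nhds) n le_rfl
  simp only [a, if_true] at this
  linarith

variable {h : ℝ → ℝ → ℝ} {a b a' b' : ℕ → ℝ} {n : ℕ}

lemma orderCoeff_congr (ha : ∀ j ≤ n, a j = a' j) (hb : ∀ j ≤ n, b j = b' j) :
    orderCoeff h a b n = orderCoeff h a' b' n := by
  have h1 (ε : ℝ) : ∑ j ∈ Finset.range (n + 1), ε ^ j * a j =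
      ∑ j ∈ Finset.range (n + 1), ε ^ j * a' j :=
    Finset.sum_congr rfl fun j hj => by rw [ha j (by simpa [Nat.lt_succ_iff] using hj)]
  have h2 (ε : ℝ) : ∑ j ∈ Finset.range (n + 1), ε ^ j * b j =
      ∑ j ∈ Finset.range (n + 1), ε ^ j * b' j :=
    Finset.sum_congr rfl fun j hj => by rw [hb j (by simpa [Nat.lt_succ_iff] using hj)]
  simp only [orderCoeff, h1, h2]

lemma orderCoeff_zero : orderCoeff h a b 0 = h (a 0) (b 0) := by
  simp [orderCoeff]

lemma sum_pow_zero (a : ℕ → ℝ) (n : ℕ) :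
    ∑ j ∈ Finset.range (n + 1), (0 : ℝ) ^ j * a j = a 0 := by
  rw [Finset.sum_range_succ']; simp

lemma tendsto_sum_pow (a : ℕ → ℝ) (n : ℕ) :
    Tendsto (fun ε : ℝ => ∑ j ∈ Finset.range (n + 1), ε ^ j * a j) (𝓝 0) (𝓝 (a 0)) := by
  have hc : Continuous fun ε : ℝ => ∑ j ∈ Finset.range (n + 1), ε ^ j * a j := by fun_prop
  simpa only [sum_pow_zero] using hc.tendsto 0

lemma contDiffAt_insert (hh : ContDiffAt ℝ ∞ (fun p : ℝ × ℝ => h p.1 p.2) (a 0, b 0)) (n : ℕ) :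
    ContDiffAt ℝ ∞ (fun ε : ℝ => h (∑ j ∈ Finset.range (n + 1), ε ^ j * a j)
      (∑ j ∈ Finset.range (n + 1), ε ^ j * b j)) 0 := by
  refine ContDiffAt.comp (0 : ℝ) (g := fun p : ℝ × ℝ => h p.1 p.2)
    (f := fun ε : ℝ => (∑ j ∈ Finset.range (n + 1), ε ^ j * a j,
      ∑ j ∈ Finset.range (n + 1), ε ^ j * b j)) ?_ (by fun_prop)
  simpa only [sum_pow_zero] using hh

/-- The coefficient of `εⁿ` is affine in the terms of order `n` of the two series. -/
lemma orderCoeff_eq_update_add (hn : 1 ≤ n)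
    (hh : ContDiffAt ℝ ∞ (fun p : ℝ × ℝ => h p.1 p.2) (a 0, b 0)) :
    orderCoeff h a b n = orderCoeff h (Function.update a n 0) (Function.update b n 0) n +
      fderiv ℝ (fun p : ℝ × ℝ => h p.1 p.2) (a 0, b 0) (a n, b n) := by
  set A := Function.update a n 0 with hA
  set B := Function.update b n 0 with hB
  have hA0 : A 0 = a 0 := Function.update_of_ne (by omega) _ _
  have hB0 : B 0 = b 0 := Function.update_of_ne (by omega) _ _
  have hsum (c : ℕ → ℝ) (ε : ℝ) : ∑ j ∈ Finset.range (n + 1), ε ^ j * c j =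
      (∑ j ∈ Finset.range (n + 1), ε ^ j * Function.update c n 0 j) + ε ^ n * c n := by
    rw [Finset.sum_range_succ, Finset.sum_range_succ, Function.update_self, mul_zero, add_zero]
    congr 1
    refine Finset.sum_congr rfl fun j hj => ?_
    rw [Function.update_of_ne (by simp at hj; omega)]
  have hh' : ContDiffAt ℝ ∞ (fun p : ℝ × ℝ => h p.1 p.2) (A 0, B 0) := by rwa [hA0, hB0]
  have h1 := (contDiffAt_insert hh n).of_le (m := n) (by exact_mod_cast le_top)
  have h2 := (contDiffAt_insert hh' n).of_le (m := n) (by exact_mod_cast le_top)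
  rw [← sub_eq_iff_eq_add', orderCoeff, orderCoeff, ← sub_div, ← iteratedDeriv_sub h1 h2]
  refine iteratedDeriv_eq_of_isLittleO (h1.sub h2) ?_
  -- Strict differentiability is the right tool because both compared points move with ε. Their
  -- difference is exactly εⁿ times the pair of terms of order n, so the remainder is o(εⁿ).
  have hst := (hh.hasStrictFDerivAt (by simp)).isLittleO
  have ht : Tendsto (fun ε : ℝ => ((∑ j ∈ Finset.range (n + 1), ε ^ j * a j,
      ∑ j ∈ Finset.range (n + 1), ε ^ j * b j), (∑ j ∈ Finset.range (n + 1), ε ^ j * A j,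
      ∑ j ∈ Finset.range (n + 1), ε ^ j * B j))) (𝓝 0) (𝓝 ((a 0, b 0), (a 0, b 0))) := by
    refine ((tendsto_sum_pow a n).prodMk_nhds (tendsto_sum_pow b n)).prodMk_nhds ?_
    rw [← hA0, ← hB0]
    exact (tendsto_sum_pow A n).prodMk_nhds (tendsto_sum_pow B n)
  have hcomp := hst.comp_tendsto ht
  have hdiff (ε : ℝ) : ((∑ j ∈ Finset.range (n + 1), ε ^ j * a j,
      ∑ j ∈ Finset.range (n + 1), ε ^ j * b j) - (∑ j ∈ Finset.range (n + 1), ε ^ j * A j,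
      ∑ j ∈ Finset.range (n + 1), ε ^ j * B j) : ℝ × ℝ) = ε ^ n • (a n, b n) := by
    rw [hsum a, hsum b]
    simp [hA, hB]
  simp only [Function.comp_def, hdiff, map_smul] at hcomp
  refine (hcomp.trans_isBigO ?_).congr_left fun ε => ?_
  · refine IsBigO.of_bound ‖(a n, b n)‖ (Eventually.of_forall fun ε => ?_)
    rw [norm_smul, mul_comm]
  · simp [smul_eq_mul]

/-- Source of the periodicity of the forces: only the angle of order zero is not periodic, and it
advances by c. Invariance for second arguments near `b 0` suffices, since the derivatives at ε = 0
are local; away from a genuine action the modulus would be meaningless. -/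
lemma orderCoeff_translate {h' : ℝ → ℝ → ℝ} {c : ℝ} (h0 : a' 0 = a 0 + c)
    (ha : ∀ j, 1 ≤ j → j ≤ n → a' j = a j) (hb : ∀ j ≤ n, b' j = b j)
    (hh : ∀ᶠ y in 𝓝 (b 0), ∀ x, h' (x + c) y = h x y) :
    orderCoeff h' a' b' n = orderCoeff h a b n := by
  have h1 (ε : ℝ) : ∑ j ∈ Finset.range (n + 1), ε ^ j * a' j =
      (∑ j ∈ Finset.range (n + 1), ε ^ j * a j) + c := by
    rw [Finset.sum_range_succ', Finset.sum_range_succ', h0]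
    rw [Finset.sum_congr rfl fun j hj => by
      rw [ha (j + 1) (by omega) (by simp at hj; omega)]]
    ring
  have h2 (ε : ℝ) : ∑ j ∈ Finset.range (n + 1), ε ^ j * b' j =
      ∑ j ∈ Finset.range (n + 1), ε ^ j * b j :=
    Finset.sum_congr rfl fun j hj => by rw [hb j (by simp at hj; omega)]
  unfold orderCoeff
  congr 1
  refine EventuallyEq.iteratedDeriv_eq n ?_
  filter_upwards [(tendsto_sum_pow b n).eventually hh] with ε hε
  rw [h1, h2, hε]

/-- Each further derivative is the differential of the previous one applied to (0, 1), which remains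
jointly smooth; the parameter will be τ. -/
lemma contDiffAt_iteratedDeriv_snd {G : ℝ × ℝ → ℝ} {p : ℝ × ℝ} (hG : ContDiffAt ℝ ∞ G p) (n : ℕ) :
    ContDiffAt ℝ ∞ (fun q : ℝ × ℝ => iteratedDeriv n (fun ε => G (q.1, ε)) q.2) p := by
  induction n with
  | zero => simpa using hG
  | succ n ih =>
    set H := fun q : ℝ × ℝ => iteratedDeriv n (fun ε => G (q.1, ε)) q.2
    have h1 : ContDiffAt ℝ ∞ (fun q => fderiv ℝ H q (0, 1)) p :=
      (ih.fderiv_right (by simp)).clm_apply contDiffAt_const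
    refine h1.congr_of_eventuallyEq ?_
    have h2 : ∀ᶠ q in 𝓝 p, ContDiffAt ℝ 1 H q :=
      (ih.of_le (by exact_mod_cast le_top)).eventually (by simp)
    filter_upwards [h2] with q hq
    rw [iteratedDeriv_succ]
    have h3 := (hq.differentiableAt (by simp)).hasFDerivAt.comp_hasDerivAt q.2
      ((hasDerivAt_const q.2 q.1).prodMk (hasDerivAt_id q.2))
    exact h3.deriv

/-- The coefficients of `f(τ, φ, I)` depend smoothly on `τ`. -/
lemma contDiff_orderCoeff {f : ℝ → ℝ → ℝ → ℝ} {φ I : ℕ → ℝ → ℝ} {n : ℕ}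
    (hφ : ∀ j ≤ n, ContDiff ℝ ∞ (φ j)) (hI : ∀ j ≤ n, ContDiff ℝ ∞ (I j))
    (hf : ∀ τ, ContDiffAt ℝ ∞ (fun q : ℝ × ℝ × ℝ => f q.1 q.2.1 q.2.2) (τ, φ 0 τ, I 0 τ)) :
    ContDiff ℝ ∞ fun τ => orderCoeff (f τ) (fun j => φ j τ) (fun j => I j τ) n := by
  refine contDiff_iff_contDiffAt.2 fun τ => ContDiffAt.div_const ?_ _
  set G : ℝ × ℝ → ℝ := fun q => f q.1 (∑ j ∈ Finset.range (n + 1), q.2 ^ j * φ j q.1)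
    (∑ j ∈ Finset.range (n + 1), q.2 ^ j * I j q.1)
  have hs {ψ : ℕ → ℝ → ℝ} (hψ : ∀ j ≤ n, ContDiff ℝ ∞ (ψ j)) :
      ContDiff ℝ ∞ fun q : ℝ × ℝ => ∑ j ∈ Finset.range (n + 1), q.2 ^ j * ψ j q.1 :=
    ContDiff.sum fun j hj => (contDiff_snd.pow j).mul
      ((hψ j (by simp at hj; omega)).comp contDiff_fst)
  have hG : ContDiffAt ℝ ∞ G (τ, 0) := by
    refine ContDiffAt.comp (τ, (0 : ℝ)) (g := fun q : ℝ × ℝ × ℝ => f q.1 q.2.1 q.2.2)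
      (f := fun q : ℝ × ℝ => (q.1, ∑ j ∈ Finset.range (n + 1), q.2 ^ j * φ j q.1,
        ∑ j ∈ Finset.range (n + 1), q.2 ^ j * I j q.1)) ?_
      (contDiffAt_fst.prodMk ((hs hφ).contDiffAt.prodMk (hs hI).contDiffAt))
    simp only [sum_pow_zero (fun j => φ j τ), sum_pow_zero (fun j => I j τ)]
    exact hf τ
  exact ContDiffAt.comp τ (g := fun q : ℝ × ℝ => iteratedDeriv n (fun ε => G (q.1, ε)) q.2)
    (f := fun t => (t, (0 : ℝ))) (contDiffAt_iteratedDeriv_snd hG n) (by fun_prop)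

end Coefficients

end Pendulum

/-! ### Recursive construction of periodic series for an abstract resonant system -/

namespace Pendulum

open scoped ContDiff Topology
open Filter MeasureTheory

section Primitive

lemma hasDerivAt_primitive {g : ℝ → ℝ} (hg : Continuous g) (τ : ℝ) :
    HasDerivAt (fun τ => ∫ t in (0 : ℝ)..τ, g t) (g τ) τ :=
  intervalIntegral.integral_hasDerivAt_right (hg.intervalIntegrable _ _)
    hg.stronglyMeasurable.stronglyMeasurableAtFilter hg.continuousAt

lemma contDiff_primitive {g : ℝ → ℝ} (hg : ContDiff ℝ ∞ g) :
    ContDiff ℝ ∞ fun τ => ∫ t in (0 : ℝ)..τ, g t := by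
  rw [contDiff_infty_iff_deriv]
  refine ⟨fun τ => (hasDerivAt_primitive hg.continuous τ).differentiableAt, ?_⟩
  rwa [funext fun τ => (hasDerivAt_primitive hg.continuous τ).deriv]

lemma periodic_primitive {g : ℝ → ℝ} {T : ℝ} (hg : Continuous g) (hp : Function.Periodic g T)
    (h0 : ∫ t in (0 : ℝ)..T, g t = 0) : Function.Periodic (fun τ => ∫ t in (0 : ℝ)..τ, g t) T := by
  intro τ
  simp only
  rw [← intervalIntegral.integral_add_adjacent_intervals (hg.intervalIntegrable 0 τ)
    (hg.intervalIntegrable τ (τ + T)), hp.intervalIntegral_add_eq τ 0, zero_add, h0, add_zero]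

end Primitive

/-- The data of a nearly integrable system `φ' = z I + W(I) + ε f₁`, `I' = ε f₂` near the
unperturbed motion `φ = a₀(τ)`, `I = b₀`, which is resonant, nondegenerate, and a nondegenerate
zero of the averaged force. -/
structure IsResonant (z : ℝ) (W : ℝ → ℝ) (f₁ f₂ : ℝ → ℝ → ℝ → ℝ) (a₀ : ℝ → ℝ) (b₀ T c : ℝ) :
    Prop where
  T_pos : 0 < T
  twist : z ≠ 0
  smooth_a : ContDiff ℝ ∞ a₀
  shift_a : ∀ τ, a₀ (τ + T) = a₀ τ + c
  smooth_W : ContDiffAt ℝ ∞ W b₀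
  deriv_W : deriv W b₀ = 0
  smooth₁ : ∀ τ x, ContDiffAt ℝ ∞ (fun q : ℝ × ℝ × ℝ => f₁ q.1 q.2.1 q.2.2) (τ, x, b₀)
  smooth₂ : ∀ τ x, ContDiffAt ℝ ∞ (fun q : ℝ × ℝ × ℝ => f₂ q.1 q.2.1 q.2.2) (τ, x, b₀)
  shift₁ : ∀ τ, ∀ᶠ y in 𝓝 b₀, ∀ x, f₁ (τ + T) (x + c) y = f₁ τ x y
  shift₂ : ∀ τ, ∀ᶠ y in 𝓝 b₀, ∀ x, f₂ (τ + T) (x + c) y = f₂ τ x y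
  mean : ∫ τ in (0 : ℝ)..T, f₂ τ (a₀ τ) b₀ = 0
  mean_deriv : ∫ τ in (0 : ℝ)..T, deriv (fun x => f₂ τ x b₀) (a₀ τ) ≠ 0

/-- The right hand side of the equation of order `n` for the angle, without the twist. -/
noncomputable def angleForce (W : ℝ → ℝ) (f₁ : ℝ → ℝ → ℝ → ℝ) (φ I : ℕ → ℝ → ℝ) (n : ℕ) (τ : ℝ) :
    ℝ :=
  orderCoeff (fun _ J => W J) (fun j => φ j τ) (fun j => I j τ) n
    + orderCoeff (f₁ τ) (fun j => φ j τ) (fun j => I j τ) (n - 1)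

/-- The right hand side of the equation of order `n` for the action. -/
noncomputable def actionForce (f₂ : ℝ → ℝ → ℝ → ℝ) (φ I : ℕ → ℝ → ℝ) (n : ℕ) (τ : ℝ) : ℝ :=
  orderCoeff (f₂ τ) (fun j => φ j τ) (fun j => I j τ) (n - 1)

/-- Periodic solutions of the equations of order at most `n`, the equation of order `n + 1` for
the action being solvable. -/
structure SolvesUpTo (z : ℝ) (W : ℝ → ℝ) (f₁ f₂ : ℝ → ℝ → ℝ → ℝ) (a₀ : ℝ → ℝ) (b₀ T : ℝ)
    (n : ℕ) (φ I : ℕ → ℝ → ℝ) : Prop where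
  phi_zero : φ 0 = a₀
  I_zero : I 0 = fun _ => b₀
  smooth_phi : ∀ j ≤ n, ContDiff ℝ ∞ (φ j)
  smooth_I : ∀ j ≤ n, ContDiff ℝ ∞ (I j)
  periodic_phi : ∀ j, 1 ≤ j → j ≤ n → Function.Periodic (φ j) T
  periodic_I : ∀ j, 1 ≤ j → j ≤ n → Function.Periodic (I j) T
  deriv_phi : ∀ j, 1 ≤ j → j ≤ n → ∀ τ,
    HasDerivAt (φ j) (z * I j τ + angleForce W f₁ φ I j τ) τ
  deriv_I : ∀ j, 1 ≤ j → j ≤ n → ∀ τ, HasDerivAt (I j) (actionForce f₂ φ I j τ) τ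
  mean : ∀ j ≤ n, ∫ τ in (0 : ℝ)..T, actionForce f₂ φ I (j + 1) τ = 0

section Force

variable {z : ℝ} {W : ℝ → ℝ} {f₁ f₂ : ℝ → ℝ → ℝ → ℝ} {a₀ : ℝ → ℝ} {b₀ T c : ℝ} {n : ℕ}
  {φ I φ' I' : ℕ → ℝ → ℝ}

lemma angleForce_congr (hφ : ∀ j ≤ n, φ j = φ' j) (hI : ∀ j ≤ n, I j = I' j) :
    angleForce W f₁ φ I n = angleForce W f₁ φ' I' n := by
  ext τ
  unfold angleForce
  congr 1
  · exact orderCoeff_congr (fun j hj => by rw [hφ j hj]) fun j hj => by rw [hI j hj]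
  · exact orderCoeff_congr (fun j hj => by rw [hφ j (by omega)]) fun j hj => by
      rw [hI j (by omega)]

lemma actionForce_congr (hφ : ∀ j ≤ n, φ j = φ' j) (hI : ∀ j ≤ n, I j = I' j) :
    actionForce f₂ φ I (n + 1) = actionForce f₂ φ' I' (n + 1) := by
  ext τ
  exact orderCoeff_congr (fun j hj => by rw [hφ j (by omega)]) fun j hj => by
    rw [hI j (by omega)]

lemma SolvesUpTo.congr (h : SolvesUpTo z W f₁ f₂ a₀ b₀ T n φ I) (hφ : ∀ j ≤ n, φ j = φ' j)
    (hI : ∀ j ≤ n, I j = I' j) : SolvesUpTo z W f₁ f₂ a₀ b₀ T n φ' I' where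
  phi_zero := by rw [← hφ 0 (Nat.zero_le n), h.phi_zero]
  I_zero := by rw [← hI 0 (Nat.zero_le n), h.I_zero]
  smooth_phi j hj := by rw [← hφ j hj]; exact h.smooth_phi j hj
  smooth_I j hj := by rw [← hI j hj]; exact h.smooth_I j hj
  periodic_phi j h1 hj := by rw [← hφ j hj]; exact h.periodic_phi j h1 hj
  periodic_I j h1 hj := by rw [← hI j hj]; exact h.periodic_I j h1 hj
  deriv_phi j h1 hj τ := by
    rw [← hφ j hj, ← hI j hj, ← angleForce_congr (fun i hi => hφ i (hi.trans hj))
      fun i hi => hI i (hi.trans hj)]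
    exact h.deriv_phi j h1 hj τ
  deriv_I j h1 hj τ := by
    obtain ⟨i, rfl⟩ := Nat.exists_eq_add_of_le' h1
    rw [← hI _ hj, ← actionForce_congr (fun i hi => hφ i (by omega)) fun i hi => hI i (by omega)]
    exact h.deriv_I _ h1 hj τ
  mean j hj := by
    rw [← actionForce_congr (fun i hi => hφ i (by omega)) fun i hi => hI i (by omega)]
    exact h.mean j hj

/-- Smoothness and periodicity of the coefficients of a force. -/
lemma IsResonant.force_regular (H : IsResonant z W f₁ f₂ a₀ b₀ T c)
    {f : ℝ → ℝ → ℝ → ℝ}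
    (hf : ∀ τ x, ContDiffAt ℝ ∞ (fun q : ℝ × ℝ × ℝ => f q.1 q.2.1 q.2.2) (τ, x, b₀))
    (hs : ∀ τ, ∀ᶠ y in 𝓝 b₀, ∀ x, f (τ + T) (x + c) y = f τ x y)
    (h0 : φ 0 = a₀) (h0' : I 0 = fun _ => b₀)
    (hφ : ∀ j ≤ n, ContDiff ℝ ∞ (φ j)) (hI : ∀ j ≤ n, ContDiff ℝ ∞ (I j))
    (hpφ : ∀ j, 1 ≤ j → j ≤ n → Function.Periodic (φ j) T)
    (hpI : ∀ j, 1 ≤ j → j ≤ n → Function.Periodic (I j) T) :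
    ContDiff ℝ ∞ (fun τ => orderCoeff (f τ) (fun j => φ j τ) (fun j => I j τ) n) ∧
    Function.Periodic (fun τ => orderCoeff (f τ) (fun j => φ j τ) (fun j => I j τ) n) T := by
  refine ⟨contDiff_orderCoeff hφ hI fun τ => by rw [h0, h0']; exact hf τ _, fun τ => ?_⟩
  refine orderCoeff_translate (c := c) (by rw [h0]; exact H.shift_a τ)
    (fun j h1 hj => hpφ j h1 hj τ) (fun j hj => ?_) (by rw [h0']; exact hs τ)
  rcases Nat.eq_zero_or_pos j with rfl | h1
  · rw [h0']
  · exact hpI j h1 hj τ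

lemma update_apply_eq (ψ : ℕ → ℝ → ℝ) (τ : ℝ) :
    (fun j => Function.update ψ n (fun _ => 0) j τ) = Function.update (fun j => ψ j τ) n 0 := by
  ext j
  by_cases h : j = n
  · subst h; simp
  · simp [Function.update_of_ne h]

/-- The inductive step of the construction of the formal series: the initial condition for the
action makes the angle periodic, the one for the angle makes the next equation solvable. -/
lemma IsResonant.exists_next (H : IsResonant z W f₁ f₂ a₀ b₀ T c)
    (h : SolvesUpTo z W f₁ f₂ a₀ b₀ T n φ I) :
    ∃ φ' I' : ℕ → ℝ → ℝ, (∀ j ≤ n, φ j = φ' j) ∧ (∀ j ≤ n, I j = I' j) ∧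
      SolvesUpTo z W f₁ f₂ a₀ b₀ T (n + 1) φ' I' := by
  have hT := H.T_pos
  -- the solution for the action
  obtain ⟨hAs, hAp⟩ := H.force_regular H.smooth₂ H.shift₂ h.phi_zero h.I_zero h.smooth_phi
    h.smooth_I h.periodic_phi h.periodic_I
  change ContDiff ℝ ∞ (actionForce f₂ φ I (n + 1)) at hAs
  change Function.Periodic (actionForce f₂ φ I (n + 1)) T at hAp
  set J : ℝ → ℝ := fun τ => ∫ t in (0 : ℝ)..τ, actionForce f₂ φ I (n + 1) t
  have hJs : ContDiff ℝ ∞ J := contDiff_primitive hAs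
  have hJp : Function.Periodic J T := periodic_primitive hAs.continuous hAp (h.mean n le_rfl)
  -- the series with vanishing terms of order `n + 1`
  set φ₀ := Function.update φ (n + 1) (fun _ => 0) with hφ₀
  set I₀ := Function.update I (n + 1) (fun _ => 0) with hI₀
  have hφ₀j (j : ℕ) (hj : j ≤ n) : φ j = φ₀ j := by rw [hφ₀, Function.update_of_ne (by omega)]
  have hI₀j (j : ℕ) (hj : j ≤ n) : I j = I₀ j := by rw [hI₀, Function.update_of_ne (by omega)]
  have h00 : φ₀ 0 = a₀ := by rw [← hφ₀j 0 (by omega), h.phi_zero]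
  have h00' : I₀ 0 = fun _ => b₀ := by rw [← hI₀j 0 (by omega), h.I_zero]
  have hreg {ψ : ℕ → ℝ → ℝ} (hs : ∀ j ≤ n, ContDiff ℝ ∞ (ψ j))
      (hp : ∀ j, 1 ≤ j → j ≤ n → Function.Periodic (ψ j) T) (v : ℝ → ℝ) (hvs : ContDiff ℝ ∞ v)
      (hvp : Function.Periodic v T) :
      (∀ j ≤ n + 1, ContDiff ℝ ∞ (Function.update ψ (n + 1) v j)) ∧
      (∀ j, 1 ≤ j → j ≤ n + 1 → Function.Periodic (Function.update ψ (n + 1) v j) T) := by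
    refine ⟨fun j hj => ?_, fun j h1 hj => ?_⟩
    · rcases hj.eq_or_lt with rfl | hj
      · rwa [Function.update_self]
      · rw [Function.update_of_ne hj.ne]; exact hs j (by omega)
    · rcases hj.eq_or_lt with rfl | hj
      · rwa [Function.update_self]
      · rw [Function.update_of_ne hj.ne]; exact hp j h1 (by omega)
  obtain ⟨hφ₀s, hφ₀p⟩ := hreg h.smooth_phi h.periodic_phi (fun _ => 0) contDiff_const
    (fun _ => rfl)
  obtain ⟨hI₀s, hI₀p⟩ := hreg h.smooth_I h.periodic_I (fun _ => 0) contDiff_const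
    (fun _ => rfl)
  -- the force for the angle does not depend on the terms of order `n + 1`
  set B : ℝ → ℝ := angleForce W f₁ φ₀ I₀ (n + 1) with hB
  have hWc (x : ℝ) : ContDiffAt ℝ ∞ (fun p : ℝ × ℝ => W p.2) (x, b₀) :=
    ContDiffAt.comp (x, b₀) (g := W) H.smooth_W contDiffAt_snd
  -- The linear part of the frequency is carried by the twist term z I, so W has zero derivative at
  -- b₀ and its coefficient of order n + 1 ignores the terms of that order.
  have hWd (x : ℝ) (v : ℝ × ℝ) : fderiv ℝ (fun p : ℝ × ℝ => W p.2) (x, b₀) v = 0 := by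
    have hW : HasFDerivAt W _ ((x, b₀) : ℝ × ℝ).2 :=
      (H.smooth_W.differentiableAt (by simp)).hasDerivAt.hasFDerivAt
    have h1 : HasFDerivAt (fun p : ℝ × ℝ => W p.2) _ (x, b₀) :=
      hW.comp (x, b₀) hasFDerivAt_snd
    rw [h1.fderiv, H.deriv_W]; simp
  have hBindep {φ' I' : ℕ → ℝ → ℝ} (h1 : ∀ j ≤ n, φ j = φ' j) (h2 : ∀ j ≤ n, I j = I' j) :
      angleForce W f₁ φ' I' (n + 1) = B := by
    ext τ
    have e0 : φ' 0 τ = a₀ τ := by rw [← h1 0 (by omega), h.phi_zero]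
    have e0' : I' 0 τ = b₀ := by rw [← h2 0 (by omega), h.I_zero]
    unfold B angleForce
    congr 1
    · rw [orderCoeff_eq_update_add (by omega) (by rw [e0']; exact hWc _), e0', hWd, add_zero]
      refine orderCoeff_congr (fun j hj => ?_) (fun j hj => ?_)
      · rcases hj.eq_or_lt with rfl | hj
        · simp [hφ₀]
        · rw [Function.update_of_ne hj.ne, ← hφ₀j j (by omega), h1 j (by omega)]
      · rcases hj.eq_or_lt with rfl | hj
        · simp [hI₀]
        · rw [Function.update_of_ne hj.ne, ← hI₀j j (by omega), h2 j (by omega)]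
    · exact orderCoeff_congr (fun j hj => by rw [← h1 j (by omega), ← hφ₀j j (by omega)])
        fun j hj => by rw [← h2 j (by omega), ← hI₀j j (by omega)]
  obtain ⟨hWs, hWp⟩ := H.force_regular (f := fun _ _ J => W J)
    (fun τ x => ContDiffAt.comp (τ, x, b₀) (g := W) (f := fun q => q.2.2) H.smooth_W
      (by fun_prop))
    (fun τ => Eventually.of_forall fun y x => rfl) h00 h00' hφ₀s hI₀s hφ₀p hI₀p
  obtain ⟨hFs, hFp⟩ := H.force_regular (n := n) H.smooth₁ H.shift₁ h00 h00'
    (fun j hj => hφ₀s j (by omega)) (fun j hj => hI₀s j (by omega))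
    (fun j h1 hj => hφ₀p j h1 (by omega)) (fun j h1 hj => hI₀p j h1 (by omega))
  have hBs : ContDiff ℝ ∞ B := hWs.add hFs
  have hBp : Function.Periodic B T := hWp.add hFp
  -- the solution for the angle
  set β : ℝ := -(∫ τ in (0 : ℝ)..T, (z * J τ + B τ)) / (z * T)
  set g : ℝ → ℝ := fun τ => z * (β + J τ) + B τ
  have hgs : ContDiff ℝ ∞ g := (contDiff_const.mul (contDiff_const.add hJs)).add hBs
  have hgp : Function.Periodic g T := fun τ => by simp only [g, hJp τ, hBp τ]
  -- β, the initial action of order n + 1, is the solution of this linear equation; z ≠ 0 makes it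
  -- solvable.
  have hg0 : ∫ τ in (0 : ℝ)..T, g τ = 0 := by
    have h1 : g = fun τ => z * β + (z * J τ + B τ) := by ext τ; simp only [g]; ring
    have hJc := hJs.continuous
    have hBc := hBs.continuous
    have hz := H.twist
    rw [h1, intervalIntegral.integral_add (by simp)
      (Continuous.intervalIntegrable (by fun_prop) _ _)]
    simp only [intervalIntegral.integral_const, smul_eq_mul, sub_zero, β]
    field_simp
    ring
  set P : ℝ → ℝ := fun τ => ∫ t in (0 : ℝ)..τ, g t
  have hPs : ContDiff ℝ ∞ P := contDiff_primitive hgs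
  have hPp : Function.Periodic P T := periodic_primitive hgs.continuous hgp hg0
  -- the next force for the action is affine in the initial condition for the angle
  obtain ⟨hRs, hRp⟩ := H.force_regular H.smooth₂ H.shift₂ h00 h00' hφ₀s hI₀s hφ₀p hI₀p
  set R : ℝ → ℝ := fun τ => orderCoeff (f₂ τ) (fun j => φ₀ j τ) (fun j => I₀ j τ) (n + 1)
  have hf₂ (τ x : ℝ) : ContDiffAt ℝ ∞ (fun p : ℝ × ℝ => f₂ τ p.1 p.2) (x, b₀) :=
    ContDiffAt.comp (x, b₀) (g := fun q : ℝ × ℝ × ℝ => f₂ q.1 q.2.1 q.2.2)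
      (f := fun p => (τ, p.1, p.2)) (H.smooth₂ τ x) (by fun_prop)
  set L : ℝ → ℝ × ℝ →L[ℝ] ℝ := fun τ => fderiv ℝ (fun p : ℝ × ℝ => f₂ τ p.1 p.2) (a₀ τ, b₀)
  -- Writing the partial differential through the full one exhibits its continuity in τ.
  have hLeq (τ : ℝ) (v : ℝ × ℝ) : L τ v =
      fderiv ℝ (fun q : ℝ × ℝ × ℝ => f₂ q.1 q.2.1 q.2.2) (τ, a₀ τ, b₀) (0, v) := by
    have h1 := ((H.smooth₂ τ (a₀ τ)).differentiableAt (by simp)).hasFDerivAt.comp (a₀ τ, b₀)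
      (hasFDerivAt_prodMk_right τ (a₀ τ, b₀))
    have h2 : HasFDerivAt (fun p : ℝ × ℝ => f₂ τ p.1 p.2) _ (a₀ τ, b₀) := h1
    simp only [L]
    rw [h2.fderiv]
    simp
  have hLc {v : ℝ → ℝ × ℝ} (hv : Continuous v) : Continuous fun τ => L τ (v τ) := by
    simp only [hLeq]
    refine Continuous.clm_apply ?_ (by fun_prop)
    rw [continuous_iff_continuousAt]
    intro τ
    exact ContinuousAt.comp (f := fun τ => (τ, a₀ τ, b₀))
      ((H.smooth₂ τ (a₀ τ)).continuousAt_fderiv (by simp))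
      (continuousAt_id.prodMk (H.smooth_a.continuous.continuousAt.prodMk continuousAt_const))
  have hLd (τ : ℝ) : L τ (1, 0) = deriv (fun x => f₂ τ x b₀) (a₀ τ) := by
    have h1 := ((hf₂ τ (a₀ τ)).differentiableAt (by simp)).hasFDerivAt.comp_hasDerivAt (a₀ τ)
      ((hasDerivAt_id (a₀ τ)).prodMk (hasDerivAt_const (a₀ τ) b₀))
    exact h1.deriv.symm
  set M := ∫ τ in (0 : ℝ)..T, L τ (1, 0)
  have hM : M ≠ 0 := by
    simp only [M, hLd]; exact H.mean_deriv
  -- The average of the force of order n + 2 is affine in the initial angle γ, with slope M; γ is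
  -- its zero.
  set γ : ℝ := -(∫ τ in (0 : ℝ)..T, (R τ + L τ (P τ, β + J τ))) / M
  refine ⟨Function.update φ (n + 1) fun τ => γ + P τ, Function.update I (n + 1) fun τ => β + J τ,
    fun j hj => by rw [Function.update_of_ne (by omega)],
    fun j hj => by rw [Function.update_of_ne (by omega)], ?_⟩
  set φ' := Function.update φ (n + 1) fun τ => γ + P τ with hφ'
  set I' := Function.update I (n + 1) fun τ => β + J τ with hI'
  have hφ'j (j : ℕ) (hj : j ≤ n) : φ j = φ' j := by rw [hφ', Function.update_of_ne (by omega)]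
  have hI'j (j : ℕ) (hj : j ≤ n) : I j = I' j := by rw [hI', Function.update_of_ne (by omega)]
  have hold := h.congr hφ'j hI'j
  obtain ⟨hφ's, hφ'p⟩ := hreg h.smooth_phi h.periodic_phi (fun τ => γ + P τ)
    (contDiff_const.add hPs) (fun τ => by simp only [hPp τ])
  obtain ⟨hI's, hI'p⟩ := hreg h.smooth_I h.periodic_I (fun τ => β + J τ)
    (contDiff_const.add hJs) (fun τ => by simp only [hJp τ])
  refine ⟨hold.phi_zero, hold.I_zero, hφ's, hI's, hφ'p, hI'p, fun j h1 hj τ => ?_,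
    fun j h1 hj τ => ?_, fun j hj => ?_⟩
  · rcases hj.eq_or_lt with rfl | hj
    · rw [hBindep hφ'j hI'j, hφ', hI', Function.update_self, Function.update_self]
      exact (hasDerivAt_primitive hgs.continuous τ).const_add γ
    · exact hold.deriv_phi j h1 (by omega) τ
  · rcases hj.eq_or_lt with rfl | hj
    · rw [← actionForce_congr hφ'j hI'j, hI', Function.update_self]
      exact (hasDerivAt_primitive hAs.continuous τ).const_add β
    · exact hold.deriv_I j h1 (by omega) τ
  · rcases hj.eq_or_lt with rfl | hj
    · have h1 (τ : ℝ) : actionForce f₂ φ' I' (n + 1 + 1) τ =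
          (R τ + L τ (P τ, β + J τ)) + γ * L τ (1, 0) := by
        have e0 : φ' 0 τ = a₀ τ := by rw [hold.phi_zero]
        have e0' : I' 0 τ = b₀ := by rw [hold.I_zero]
        have e1 : φ' (n + 1) τ = γ + P τ := by rw [hφ', Function.update_self]
        have e1' : I' (n + 1) τ = β + J τ := by rw [hI', Function.update_self]
        change orderCoeff (f₂ τ) (fun j => φ' j τ) (fun j => I' j τ) (n + 1) = _
        rw [orderCoeff_eq_update_add (by omega) (by rw [e0, e0']; exact hf₂ τ _),
          ← update_apply_eq, ← update_apply_eq, hφ', hI', Function.update_idem,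
          Function.update_idem, ← hφ', ← hI', e0, e0', e1, e1', add_assoc]
        congr 1
        change L τ _ = _
        rw [show (γ + P τ, β + J τ) = (P τ, β + J τ) + γ • ((1, 0) : ℝ × ℝ) by
          ext <;> simp [add_comm], map_add, map_smul, smul_eq_mul]
      have hc1 : Continuous fun τ => R τ + L τ (P τ, β + J τ) :=
        hRs.continuous.add (hLc (hPs.continuous.prodMk (continuous_const.add hJs.continuous)))
      have hc2 : Continuous fun τ => L τ (1, 0) := hLc continuous_const
      have hc3 : Continuous fun τ => γ * L τ (1, 0) := continuous_const.mul hc2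
      simp only [h1]
      rw [intervalIntegral.integral_add (hc1.intervalIntegrable _ _)
        (hc3.intervalIntegrable _ _), intervalIntegral.integral_const_mul]
      change _ + γ * M = 0
      simp only [γ]
      field_simp
      ring
    · exact hold.mean j (by omega)

/-- Existence of a formal series of periodic functions. -/
theorem IsResonant.exists_solution (H : IsResonant z W f₁ f₂ a₀ b₀ T c) :
    ∃ φ I : ℕ → ℝ → ℝ, ∀ n, SolvesUpTo z W f₁ f₂ a₀ b₀ T n φ I := by
  have h0 : SolvesUpTo z W f₁ f₂ a₀ b₀ T 0 (fun _ => a₀) (fun _ _ => b₀) :=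
    ⟨rfl, rfl, fun _ _ => H.smooth_a, fun _ _ => contDiff_const, fun j h1 hj => by omega,
      fun j h1 hj => by omega, fun j h1 hj => by omega, fun j h1 hj => by omega, fun j hj => by
        obtain rfl : j = 0 := by omega
        simpa [actionForce, orderCoeff_zero] using H.mean⟩
  let S (n : ℕ) := {s : (ℕ → ℝ → ℝ) × (ℕ → ℝ → ℝ) // SolvesUpTo z W f₁ f₂ a₀ b₀ T n s.1 s.2}
  have hnext (n : ℕ) (s : S n) : ∃ s' : S (n + 1), (∀ j ≤ n, s.1.1 j = s'.1.1 j) ∧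
      ∀ j ≤ n, s.1.2 j = s'.1.2 j := by
    obtain ⟨φ', I', h1, h2, h3⟩ := H.exists_next s.2
    exact ⟨⟨(φ', I'), h3⟩, h1, h2⟩
  choose next hn1 hn2 using hnext
  -- Dependent choice. A later stage never alters the orders already solved, so the diagonal
  -- sequence solves all the equations.
  let s : (n : ℕ) → S n := fun n => Nat.rec ⟨(_, _), h0⟩ (fun n s => next n s) n
  have hs (m n : ℕ) (hmn : m ≤ n) : ∀ j ≤ m, (s n).1.1 j = (s m).1.1 j ∧
      (s n).1.2 j = (s m).1.2 j := by
    induction n, hmn using Nat.le_induction with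
    | base => exact fun j _ => ⟨rfl, rfl⟩
    | succ n hmn ih =>
      intro j hj
      obtain ⟨e1, e2⟩ := ih j hj
      exact ⟨(hn1 n (s n) j (hj.trans hmn)).symm.trans e1,
        (hn2 n (s n) j (hj.trans hmn)).symm.trans e2⟩
  exact ⟨fun j => (s j).1.1 j, fun j => (s j).1.2 j, fun n =>
    (s n).2.congr (fun j hj => (hs j n hj j le_rfl).1) fun j hj => (hs j n hj j le_rfl).2⟩

end Force

end Pendulum

/-! ### Averages along the unperturbed rotation and the sign of `G₁` -/

namespace Pendulum

open scoped ContDiff Topology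
open Filter MeasureTheory

/-- The product `sn cn dn`, proportional to the derivative of `dn²`. -/
noncomputable def scd (u k : ℝ) : ℝ := sn u k * cn u k * dn u k

section Scd

variable {k : ℝ}

lemma continuous_scd (hk : k ^ 2 < 1) : Continuous fun u => scd u k :=
  ((continuous_sn hk).mul (continuous_cn hk)).mul (continuous_dn hk)

lemma scd_neg (hk : k ^ 2 < 1) (u : ℝ) : scd (-u) k = -scd u k := by
  simp [scd, sn_neg hk, cn_neg hk, dn_neg hk]

lemma scd_add (hk : k ^ 2 < 1) (u : ℝ) : scd (u + 2 * ellK k) k = scd u k := by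
  simp [scd, sn_add hk, cn_add hk, dn_add hk]

lemma hasDerivAt_dn_sq (hk : k ^ 2 < 1) (u : ℝ) :
    HasDerivAt (fun u => dn u k ^ 2) (-(2 * k ^ 2 * scd u k)) u :=
  ((hasDerivAt_dn hk u).pow 2).congr_deriv (by unfold scd; ring)

lemma exists_hasDerivAt_scd (hk : k ^ 2 < 1) :
    ∃ s' : ℝ → ℝ, Continuous s' ∧ ∀ u, HasDerivAt (fun u => scd u k) (s' u) u := by
  refine ⟨fun u => (cn u k * dn u k * cn u k + sn u k * -(sn u k * dn u k)) * dn u k +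
    sn u k * cn u k * -(k ^ 2 * sn u k * cn u k), ?_,
    fun u => ((hasDerivAt_sn hk u).mul (hasDerivAt_cn hk u)).mul (hasDerivAt_dn hk u)⟩
  have h1 := continuous_sn hk
  have h2 := continuous_cn hk
  have h3 := continuous_dn hk
  fun_prop

end Scd

section Averages

lemma integral_eq_zero_of_odd_of_periodic {f : ℝ → ℝ} {T : ℝ} (hf : ∀ u, f (-u) = -f u)
    (hp : Function.Periodic f T) : ∫ τ in (0 : ℝ)..T, f τ = 0 := by
  have h := hp.intervalIntegral_add_eq 0 (-(T / 2))
  rw [zero_add, show -(T / 2) + T = T / 2 by ring] at h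
  rw [h, integral_eq_zero_of_odd hf]

lemma integral_nat_mul_of_periodic {f : ℝ → ℝ} {S : ℝ} (hc : Continuous f)
    (hp : Function.Periodic f S) (n : ℕ) :
    ∫ τ in (0 : ℝ)..(n * S), f τ = n * ∫ τ in (0 : ℝ)..S, f τ := by
  have := hp.intervalIntegral_add_zsmul_eq n 0 fun _ _ => hc.intervalIntegrable _ _
  simpa using this

/-- The rotation of modulus `k` of the pendulum, covered `p` times in the double period of `sn`,
resonates with the period `2π` of the forcing, covered `q` times. -/
structure Resonance (α k T : ℝ) (p q : ℕ) : Prop where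
  alpha_pos : 0 < α
  mem : k ∈ Ioo (0 : ℝ) 1
  p_pos : 0 < p
  q_pos : 0 < q
  T_eq : T = 2 * π * q
  res : T = 4 * k * ellK k * p / √α

variable {α k T : ℝ} {p q : ℕ}

namespace Resonance

lemma sqrt_pos (R : Resonance α k T p q) : 0 < √α := Real.sqrt_pos.2 R.alpha_pos

lemma sq_lt_one (R : Resonance α k T p q) : k ^ 2 < 1 := sq_lt_one_of_mem R.mem

lemma ellK_pos (R : Resonance α k T p q) : 0 < ellK k := Pendulum.ellK_pos R.sq_lt_one

lemma k_pos (R : Resonance α k T p q) : 0 < k := R.mem.1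

lemma T_pos (R : Resonance α k T p q) : 0 < T := by
  have := R.q_pos
  rw [R.T_eq]; positivity

lemma T_eq_mul (R : Resonance α k T p q) : T = (2 * p : ℕ) * (2 * k * ellK k / √α) := by
  rw [R.res]; push_cast; ring

lemma periodic_half (R : Resonance α k T p q) {f : ℝ → ℝ}
    (hf : ∀ u, f (u + 2 * ellK k) = f u) :
    Function.Periodic (fun τ => f (√α / k * τ)) (2 * k * ellK k / √α) := fun τ => by
  have h1 := R.sqrt_pos.ne'
  have h2 := R.k_pos.ne'
  have h3 : √α / k * (τ + 2 * k * ellK k / √α) = √α / k * τ + 2 * ellK k := by field_simp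
  simp only [h3, hf]

lemma periodic (R : Resonance α k T p q) {f : ℝ → ℝ} (hf : ∀ u, f (u + 2 * ellK k) = f u) :
    Function.Periodic (fun τ => f (√α / k * τ)) T := by
  rw [R.T_eq_mul]
  exact (R.periodic_half hf).nat_mul _

lemma sin_add (R : Resonance α k T p q) (τ : ℝ) : sin (τ + T) = sin τ := by
  rw [R.T_eq, mul_comm (2 * π)]
  exact sin_add_nat_mul_two_pi _ _

lemma cos_add (R : Resonance α k T p q) (τ : ℝ) : cos (τ + T) = cos τ := by
  rw [R.T_eq, mul_comm (2 * π)]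
  exact cos_add_nat_mul_two_pi _ _

lemma periodic_scd (R : Resonance α k T p q) :
    Function.Periodic (fun τ => scd (√α / k * τ) k) T :=
  R.periodic (f := fun u => scd u k) (scd_add R.sq_lt_one)

lemma continuous_scd (R : Resonance α k T p q) : Continuous fun τ => scd (√α / k * τ) k :=
  (Pendulum.continuous_scd R.sq_lt_one).comp (continuous_const.mul continuous_id)

lemma continuous_dn (R : Resonance α k T p q) : Continuous fun τ => dn (√α / k * τ) k :=
  (Pendulum.continuous_dn R.sq_lt_one).comp (continuous_const.mul continuous_id)

lemma integral_scd (R : Resonance α k T p q) :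
    ∫ τ in (0 : ℝ)..T, scd (√α / k * τ) k = 0 :=
  integral_eq_zero_of_odd_of_periodic (fun τ => by rw [mul_neg, scd_neg R.sq_lt_one])
    R.periodic_scd

lemma integral_scd_mul_cos (R : Resonance α k T p q) :
    ∫ τ in (0 : ℝ)..T, scd (√α / k * τ) k * cos τ = 0 := by
  refine integral_eq_zero_of_odd_of_periodic
    (fun τ => by rw [mul_neg, scd_neg R.sq_lt_one, cos_neg, neg_mul]) fun τ => ?_
  have h := R.periodic_scd τ
  simp only at h ⊢
  rw [h, R.cos_add]

lemma integral_scd_mul_sin (R : Resonance α k T p q) :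
    ∫ τ in (0 : ℝ)..T, scd (√α / k * τ) k * sin τ = T * G₁ α k T := by
  rw [G₁, avg, ← mul_assoc, mul_one_div_cancel R.T_pos.ne', one_mul]
  rfl

lemma integral_dn_sq (R : Resonance α k T p q) :
    ∫ τ in (0 : ℝ)..T, dn (√α / k * τ) k ^ 2 = T * Delta α k := by
  have h1 := R.sqrt_pos.ne'
  have h2 := R.k_pos.ne'
  have h3 := R.ellK_pos.ne'
  have hd := R.continuous_dn
  have hc : Continuous fun τ => dn (√α / k * τ) k ^ 2 := by fun_prop
  -- T contains 2p periods of dn², and `Delta` is the average over one of them.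
  have h := integral_nat_mul_of_periodic hc (R.periodic_half
    (f := fun u => dn u k ^ 2) (fun u => by rw [dn_add R.sq_lt_one])) (2 * p)
  rw [← R.T_eq_mul] at h
  rw [h, R.T_eq_mul, Delta]
  field_simp

lemma Delta_pos (R : Resonance α k T p q) : 0 < Delta α k := by
  have h : 0 < T * Delta α k := by
    rw [← R.integral_dn_sq]
    exact intervalIntegral.intervalIntegral_pos_of_pos
      ((R.continuous_dn.pow 2).intervalIntegrable _ _) (fun τ => pow_pos (dn_pos R.sq_lt_one _) 2)
      R.T_pos
  exact pos_of_mul_pos_right h R.T_pos.le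

/-- The force for the action, at the action of the unperturbed rotation. -/
lemma fieldI_rotAction (R : Resonance α k T p q) (C₁ τ₀ τ x : ℝ) :
    fieldI α C₁ τ₀ τ x (rotAction α k) =
      4 * ellK k / π * cos (τ - τ₀) * scd (ellK k / π * x) k
        - 4 * C₁ * √α * ellK k / (π * k) * dn (ellK k / π * x) k ^ 2 := by
  simp only [fieldI, rotModulus_rotAction R.alpha_pos R.mem, scd]

lemma angle_eq (R : Resonance α k T p q) (τ : ℝ) :
    ellK k / π * (π / ellK k * √α * (τ / k)) = √α / k * τ := by
  have := R.ellK_pos.ne'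
  field_simp

/-- The average of the force for the action along the unperturbed rotation. -/
lemma integral_fieldI (R : Resonance α k T p q) (C₁ τ₀ : ℝ) :
    ∫ τ in (0 : ℝ)..T, fieldI α C₁ τ₀ τ (π / ellK k * √α * (τ / k)) (rotAction α k) =
      4 * ellK k / π * T * (sin τ₀ * G₁ α k T - C₁ * √α / k * Delta α k) := by
  have hs := R.continuous_scd
  have hd := R.continuous_dn
  have h (τ : ℝ) : fieldI α C₁ τ₀ τ (π / ellK k * √α * (τ / k)) (rotAction α k) =
      4 * ellK k / π * cos τ₀ * (scd (√α / k * τ) k * cos τ)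
        + 4 * ellK k / π * sin τ₀ * (scd (√α / k * τ) k * sin τ)
        - 4 * C₁ * √α * ellK k / (π * k) * dn (√α / k * τ) k ^ 2 := by
    rw [R.fieldI_rotAction, R.angle_eq, cos_sub]; ring
  simp only [h]
  rw [intervalIntegral.integral_sub (Continuous.intervalIntegrable (by fun_prop) _ _)
      (Continuous.intervalIntegrable (by fun_prop) _ _),
    intervalIntegral.integral_add (Continuous.intervalIntegrable (by fun_prop) _ _)
      (Continuous.intervalIntegrable (by fun_prop) _ _),
    intervalIntegral.integral_const_mul, intervalIntegral.integral_const_mul,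
    intervalIntegral.integral_const_mul, R.integral_scd_mul_cos, R.integral_scd_mul_sin,
    R.integral_dn_sq]
  have := R.k_pos.ne'
  field_simp
  ring

lemma integral_fieldI_eq_zero_iff (R : Resonance α k T p q) (C₁ τ₀ : ℝ) :
    ∫ τ in (0 : ℝ)..T, fieldI α C₁ τ₀ τ (π / ellK k * √α * (τ / k)) (rotAction α k) = 0 ↔
      C₁ = k * sin τ₀ / (√α * Delta α k) * G₁ α k T := by
  have hK := R.ellK_pos
  have hT := R.T_pos
  have h1 := R.sqrt_pos.ne'
  have h2 := R.k_pos.ne'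
  have h3 := R.Delta_pos.ne'
  rw [R.integral_fieldI, mul_eq_zero, or_iff_right (by positivity), sub_eq_zero]
  constructor
  · intro h
    field_simp at h ⊢
    linarith
  · rintro rfl
    field_simp

/-- The derivative of the averaged force with respect to the phase. -/
lemma integral_deriv_fieldI (R : Resonance α k T p q) (C₁ τ₀ : ℝ) :
    ∫ τ in (0 : ℝ)..T, deriv (fun x => fieldI α C₁ τ₀ τ x (rotAction α k))
        (π / ellK k * √α * (τ / k)) =
      4 * ellK k ^ 2 * k / (π ^ 2 * √α) * cos τ₀ * (T * G₁ α k T) := by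
  obtain ⟨s', hs'c, hs'⟩ := exists_hasDerivAt_scd R.sq_lt_one
  have h1 := R.sqrt_pos.ne'
  have h2 := R.k_pos.ne'
  have hs := R.continuous_scd
  set A := 4 * ellK k ^ 2 / π ^ 2
  -- B collects the damping: the phase derivative of dn² is a multiple of sn cn dn, whose average is
  -- zero. Only the forcing contributes in the end.
  set B := 8 * C₁ * √α * ellK k ^ 2 * k / π ^ 2
  have hd (τ : ℝ) : deriv (fun x => fieldI α C₁ τ₀ τ x (rotAction α k))
      (π / ellK k * √α * (τ / k)) =
      A * (cos (τ - τ₀) * s' (√α / k * τ)) + B * scd (√α / k * τ) k := by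
    have hl : HasDerivAt (fun x => ellK k / π * x) (ellK k / π) (π / ellK k * √α * (τ / k)) :=
      ((hasDerivAt_id _).const_mul _).congr_deriv (mul_one _)
    have e1 := HasDerivAt.comp (π / ellK k * √α * (τ / k))
      (h₂ := fun u => scd u k) (h := fun x => ellK k / π * x) (hs' _) hl
    have e2 := HasDerivAt.comp (π / ellK k * √α * (τ / k))
      (h₂ := fun u => dn u k ^ 2) (h := fun x => ellK k / π * x)
      (hasDerivAt_dn_sq R.sq_lt_one _) hl
    simp only [R.fieldI_rotAction]
    have e := (e1.const_mul (4 * ellK k / π * cos (τ - τ₀))).sub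
      (e2.const_mul (4 * C₁ * √α * ellK k / (π * k)))
    rw [R.angle_eq] at e
    refine e.deriv.trans ?_
    simp only [A, B]
    field_simp
    ring
  have hcos : Continuous fun τ => cos (τ - τ₀) * s' (√α / k * τ) := by fun_prop
  have hparts := intervalIntegral.integral_mul_deriv_eq_deriv_mul (a := 0) (b := T)
    (u := fun τ => cos (τ - τ₀)) (u' := fun τ => -sin (τ - τ₀))
    (v := fun τ => scd (√α / k * τ) k) (v' := fun τ => √α / k * s' (√α / k * τ))
    (fun τ _ => ((hasDerivAt_id τ).sub_const τ₀).cos.congr_deriv (by simp))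
    (fun τ _ => (HasDerivAt.comp τ (h₂ := fun u => scd u k) (h := fun τ => √α / k * τ) (hs' _)
      (((hasDerivAt_id τ).const_mul _).congr_deriv (mul_one _))).congr_deriv (mul_comm _ _))
    (Continuous.intervalIntegrable (by fun_prop) _ _)
    (Continuous.intervalIntegrable (by fun_prop) _ _)
  have hs0 : scd (√α / k * 0) k = 0 := by simp [scd, sn, am_zero R.sq_lt_one]
  have hsT : scd (√α / k * T) k = 0 := by
    have := R.periodic_scd 0
    simp only [zero_add] at this
    rw [this, hs0]
  have hR : ∫ τ in (0 : ℝ)..T, -sin (τ - τ₀) * scd (√α / k * τ) k =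
      -(cos τ₀ * (T * G₁ α k T)) := by
    have h (τ : ℝ) : -sin (τ - τ₀) * scd (√α / k * τ) k =
        sin τ₀ * (scd (√α / k * τ) k * cos τ) - cos τ₀ * (scd (√α / k * τ) k * sin τ) := by
      rw [sin_sub]; ring
    simp only [h]
    rw [intervalIntegral.integral_sub (Continuous.intervalIntegrable (by fun_prop) _ _)
      (Continuous.intervalIntegrable (by fun_prop) _ _), intervalIntegral.integral_const_mul,
      intervalIntegral.integral_const_mul, R.integral_scd_mul_cos, R.integral_scd_mul_sin]
    ring
  have hL : ∫ τ in (0 : ℝ)..T, cos (τ - τ₀) * (√α / k * s' (√α / k * τ)) =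
      √α / k * ∫ τ in (0 : ℝ)..T, cos (τ - τ₀) * s' (√α / k * τ) := by
    rw [← intervalIntegral.integral_const_mul]
    congr 1; ext τ; ring
  rw [hL, hsT, hs0, hR, mul_zero, mul_zero, sub_zero, zero_sub, neg_neg] at hparts
  simp only [hd]
  rw [intervalIntegral.integral_add (Continuous.intervalIntegrable (by fun_prop) _ _)
      (Continuous.intervalIntegrable (by fun_prop) _ _),
    intervalIntegral.integral_const_mul, intervalIntegral.integral_const_mul, R.integral_scd,
    mul_zero, add_zero]
  have : ∫ τ in (0 : ℝ)..T, cos (τ - τ₀) * s' (√α / k * τ) =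
      k / √α * (cos τ₀ * (T * G₁ α k T)) := by
    rw [← hparts, ← mul_assoc, div_mul_div_cancel₀ h1, div_self h2, one_mul]
  rw [this]
  simp only [A]
  field_simp

/-- The average `G₁` vanishes unless `q` is an even multiple of `p`. -/
lemma exists_eq_of_G₁_ne_zero (R : Resonance α k T p q) (hG : G₁ α k T ≠ 0) :
    ∃ m : ℕ, 1 ≤ m ∧ q = 2 * m * p := by
  set S := 2 * k * ellK k / √α with hS
  have hs := R.continuous_scd
  have hper : Function.Periodic (fun τ => scd (√α / k * τ) k * sin τ) T := fun τ => by
    have h := R.periodic_scd τ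
    simp only at h ⊢
    rw [h, R.sin_add]
  -- Shifting by the period S of sn cn dn turns sin τ into cos S sin τ + sin S cos τ, and the cosine
  -- part integrates to zero by parity. A nonzero integral thus requires cos S = 1.
  have hshift := hper.intervalIntegral_add_eq S 0
  rw [zero_add, add_comm S T, ← zero_add S, ← add_assoc, add_zero,
    ← intervalIntegral.integral_comp_add_right
      (fun τ => scd (√α / k * τ) k * sin τ)] at hshift
  have hS' (τ : ℝ) : scd (√α / k * (τ + S)) k = scd (√α / k * τ) k :=
    R.periodic_half (f := fun u => scd u k) (scd_add R.sq_lt_one) τ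
  have h1 (τ : ℝ) : scd (√α / k * (τ + S)) k * sin (τ + S) =
      cos S * (scd (√α / k * τ) k * sin τ) + sin S * (scd (√α / k * τ) k * cos τ) := by
    rw [hS', Real.sin_add]; ring
  simp only [h1] at hshift
  rw [intervalIntegral.integral_add (Continuous.intervalIntegrable (by fun_prop) _ _)
      (Continuous.intervalIntegrable (by fun_prop) _ _),
    intervalIntegral.integral_const_mul, intervalIntegral.integral_const_mul,
    R.integral_scd_mul_cos, R.integral_scd_mul_sin, mul_zero, add_zero] at hshift
  have hX : T * G₁ α k T ≠ 0 := mul_ne_zero R.T_pos.ne' hG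
  have hcos : cos S = 1 := mul_right_cancel₀ hX (by rw [hshift, one_mul])
  obtain ⟨j, hj⟩ := (cos_eq_one_iff S).1 hcos
  have hTS : (2 * p : ℕ) * S = 2 * π * q := by rw [← R.T_eq_mul, R.T_eq]
  rw [← hj] at hTS
  have hq : (q : ℤ) = 2 * j * p := by
    have hpi := pi_pos.ne'
    have : (q : ℝ) = 2 * j * p := by
      push_cast at hTS
      have h2 : (2 * π) * (q : ℝ) = (2 * π) * (2 * j * p) := by rw [← hTS]; ring
      exact mul_left_cancel₀ (by positivity) h2
    exact_mod_cast this
  have hp := R.p_pos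
  have hq0 := R.q_pos
  have hj0 : 0 < j := by
    by_contra hneg
    have : j * (p : ℤ) ≤ 0 := mul_nonpos_of_nonpos_of_nonneg (not_lt.1 hneg) (by omega)
    nlinarith
  obtain ⟨m, rfl⟩ := Int.eq_ofNat_of_zero_le hj0.le
  exact ⟨m, by omega, by exact_mod_cast hq⟩

/-- The average `G₁` is positive if `p = 1` and `q` is even. -/
lemma G₁_pos {m : ℕ} (R : Resonance α k T 1 (2 * m)) : 0 < G₁ α k T := by
  have hsq := R.sqrt_pos
  have h2 := R.k_pos
  have hK := R.ellK_pos
  have hd := R.continuous_dn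
  have hs := R.continuous_scd
  set w := √α / k with hw
  have hw0 : 0 < w := div_pos hsq h2
  set S := 2 * k * ellK k / √α with hS
  have hSw : w * (S / 2) = ellK k := by rw [hw, hS]; field_simp
  have hm0 : 0 < m := by have := R.q_pos; omega
  have hS0 : 0 < S := by positivity
  have hS2 : S = m * (2 * π) := by
    have := R.T_eq_mul
    rw [R.T_eq] at this
    push_cast at this
    linarith
  have hfreq (u : ℝ) : cos (m * π / ellK k * (w * u)) = cos u := by
    congr 1
    have h4 : m * π = S / 2 := by rw [hS2]; ring
    rw [h4, ← hSw]
    field_simp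
  -- Since sn cn dn is a negative multiple of the derivative of dn², moving the derivative onto sin
  -- τ yields the integral of cos τ dn² with a positive factor.
  have hparts := intervalIntegral.integral_mul_deriv_eq_deriv_mul (a := 0) (b := T)
    (u := fun τ => sin τ) (u' := fun τ => cos τ)
    (v := fun τ => dn (w * τ) k ^ 2) (v' := fun τ => -(2 * k ^ 2 * w) * scd (w * τ) k)
    (fun τ _ => hasDerivAt_sin τ)
    (fun τ _ => (HasDerivAt.comp τ (h₂ := fun u => dn u k ^ 2) (h := fun τ => w * τ)
      (hasDerivAt_dn_sq R.sq_lt_one _)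
      (((hasDerivAt_id τ).const_mul _).congr_deriv (mul_one _))).congr_deriv (by ring))
    (Continuous.intervalIntegrable (by fun_prop) _ _)
    (Continuous.intervalIntegrable (by fun_prop) _ _)
  have hsinT : sin T = 0 := by have := R.sin_add 0; rwa [zero_add, sin_zero] at this
  have hL : ∫ τ in (0 : ℝ)..T, sin τ * (-(2 * k ^ 2 * w) * scd (w * τ) k) =
      -(2 * k ^ 2 * w) * (T * G₁ α k T) := by
    rw [← R.integral_scd_mul_sin, ← intervalIntegral.integral_const_mul]
    congr 1; ext τ; ring
  rw [hL, hsinT, sin_zero, zero_mul, zero_mul, sub_zero, zero_sub] at hparts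
  have hper : Function.Periodic (fun τ => cos τ * dn (w * τ) k ^ 2) S := fun τ => by
    have h := R.periodic_half (f := fun u => dn u k) (dn_add R.sq_lt_one) τ
    simp only at h ⊢
    rw [h, hS2, cos_add_nat_mul_two_pi]
  have h5 : ∫ τ in (0 : ℝ)..T, cos τ * dn (w * τ) k ^ 2 =
      2 * ∫ τ in (0 : ℝ)..S, cos τ * dn (w * τ) k ^ 2 := by
    have := integral_nat_mul_of_periodic (by fun_prop) hper (2 * 1)
    rw [← R.T_eq_mul] at this
    rw [this]; norm_num
  -- With S = 2πm, the substitution u = wτ maps a centred period onto [-K, K] and cos τ onto the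
  -- m-th harmonic.
  have h6 : ∫ τ in (0 : ℝ)..S, cos τ * dn (w * τ) k ^ 2 =
      w⁻¹ * ∫ u in (-ellK k)..(ellK k), dn u k ^ 2 * cos (m * π / ellK k * u) := by
    have h7 := hper.intervalIntegral_add_eq 0 (-(S / 2))
    rw [zero_add, show -(S / 2) + S = S / 2 by ring] at h7
    have h8 := intervalIntegral.integral_comp_mul_left (a := -(S / 2)) (b := S / 2)
      (fun u => dn u k ^ 2 * cos (m * π / ellK k * u)) hw0.ne'
    rw [mul_neg, hSw, smul_eq_mul] at h8
    rw [h7, ← h8]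
    congr 1; ext τ
    rw [hfreq]; ring
  have h9 := integral_dn_sq_mul_cos_pos h2.ne' R.sq_lt_one m
  have h10 : 0 < ∫ τ in (0 : ℝ)..T, cos τ * dn (w * τ) k ^ 2 := by
    rw [h5, h6]; positivity
  have h11 : (2 * k ^ 2 * w * T) * G₁ α k T = ∫ τ in (0 : ℝ)..T, cos τ * dn (w * τ) k ^ 2 := by
    linarith
  rw [← h11] at h10
  have hT := R.T_pos
  exact pos_of_mul_pos_right h10 (by positivity)

/-- The perturbed pendulum near a resonant rotation fits the hypotheses of the construction of
periodic formal series. -/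
lemma isResonant (R : Resonance α k T p q) {C₁ τ₀ : ℝ}
    (hC : C₁ = k * sin τ₀ / (√α * Delta α k) * G₁ α k T) (hcos : cos τ₀ ≠ 0)
    (hG : G₁ α k T ≠ 0) :
    IsResonant (rotZeta α (rotAction α k))
      (fun J => rotFreq α J - rotZeta α (rotAction α k) * J)
      (fieldPhi α C₁ τ₀) (fieldI α C₁ τ₀) (fun τ => π / ellK k * √α * (τ / k)) (rotAction α k) T
      ((2 * p : ℕ) * (2 * π)) where
  T_pos := R.T_pos
  twist := rotZeta_ne_zero R.alpha_pos R.mem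
  smooth_a := by fun_prop
  -- T is 2p times the period 2kK/√α of a full turn, so the angle advances by 2p times 2π.
  shift_a τ := by
    have h1 := R.sqrt_pos.ne'
    have h2 := R.k_pos.ne'
    have h3 := R.ellK_pos.ne'
    rw [R.res]
    push_cast
    field_simp
    ring
  smooth_W := (contDiffAt_rotFreq R.alpha_pos R.mem).sub (by fun_prop)
  deriv_W := by
    have h1 := ((contDiffAt_rotFreq R.alpha_pos R.mem).differentiableAt (by simp)).hasDerivAt
    have h2 := h1.sub ((hasDerivAt_id (rotAction α k)).const_mul (rotZeta α (rotAction α k)))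
    refine h2.deriv.trans ?_
    rw [mul_one, rotZeta, sub_self]
  smooth₁ := contDiffAt_fieldPhi R.alpha_pos R.mem
  smooth₂ := contDiffAt_fieldI R.alpha_pos R.mem
  shift₁ τ := by
    filter_upwards [rotModulus_mem R.alpha_pos R.mem] with J hJ x
    rw [R.T_eq]
    exact (field_add hJ (2 * p) q τ x).2
  shift₂ τ := by
    filter_upwards [rotModulus_mem R.alpha_pos R.mem] with J hJ x
    rw [R.T_eq]
    exact (field_add hJ (2 * p) q τ x).1
  mean := (R.integral_fieldI_eq_zero_iff C₁ τ₀).2 hC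
  mean_deriv := by
    have h1 := R.sqrt_pos
    have h2 := R.k_pos
    have h3 := R.ellK_pos
    have h4 := R.T_pos
    rw [R.integral_deriv_fieldI]
    exact mul_ne_zero (mul_ne_zero (by positivity) hcos) (mul_ne_zero h4.ne' hG)

lemma avg_F₂_one_eq_zero_iff (R : Resonance α k T p q) {C₁ τ₀ : ℝ} {φbar Ibar : ℕ → ℝ}
    {φ I : ℕ → ℝ → ℝ} (h : IsFormalSolution α k C₁ τ₀ φbar Ibar φ I) :
    avg T (F₂ α C₁ τ₀ φ I 1) = 0 ↔ C₁ = k * sin τ₀ / (√α * Delta α k) * G₁ α k T := by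
  rw [← R.integral_fieldI_eq_zero_iff, avg, mul_eq_zero,
    or_iff_right (one_div_pos.2 R.T_pos).ne']
  have hF (τ : ℝ) : F₂ α C₁ τ₀ φ I 1 τ =
      fieldI α C₁ τ₀ τ (π / ellK k * √α * (τ / k)) (rotAction α k) := by
    rw [F₂, Nat.sub_self, orderCoeff_zero, h.phi_zero, h.I_zero]
  simp only [hF]

/-- Existence of periodic formal series solutions near a nondegenerate zero of the average. -/
lemma exists_periodic (R : Resonance α k T p q) {C₁ τ₀ : ℝ}
    (hC : C₁ = k * sin τ₀ / (√α * Delta α k) * G₁ α k T) (hcos : cos τ₀ ≠ 0)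
    (hG : G₁ α k T ≠ 0) :
    ∃ (φbar Ibar : ℕ → ℝ) (φ I : ℕ → ℝ → ℝ), IsFormalSolution α k C₁ τ₀ φbar Ibar φ I ∧
      ∀ n : ℕ, 1 ≤ n → Function.Periodic (φ n) T ∧ Function.Periodic (I n) T ∧
        Continuous (F₂ α C₁ τ₀ φ I n) ∧ Function.Periodic (F₂ α C₁ τ₀ φ I n) T ∧
        avg T (F₂ α C₁ τ₀ φ I n) = 0 := by
  have H := R.isResonant hC hcos hG
  obtain ⟨φ, I, h⟩ := H.exists_solution
  refine ⟨fun n => φ n 0, fun n => I n 0, φ, I, ⟨fun τ => by rw [(h 0).phi_zero],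
    fun τ => by rw [(h 0).I_zero], fun _ _ => rfl, fun _ _ => rfl,
    fun n hn => (h n).deriv_phi n hn le_rfl, fun n hn => (h n).deriv_I n hn le_rfl⟩,
    fun n hn => ?_⟩
  obtain ⟨j, rfl⟩ := Nat.exists_eq_add_of_le' hn
  obtain ⟨h1, h2⟩ := H.force_regular H.smooth₂ H.shift₂ (h j).phi_zero (h j).I_zero
    (h j).smooth_phi (h j).smooth_I (h j).periodic_phi (h j).periodic_I
  refine ⟨(h _).periodic_phi _ hn le_rfl, (h _).periodic_I _ hn le_rfl, h1.continuous, h2, ?_⟩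
  rw [avg]
  exact mul_eq_zero_of_right _ ((h j).mean j le_rfl)

end Resonance

end Averages

end Pendulum

/-! ### The three assertions assembled -/

theorem lemma2 (α k₂ T : ℝ) (hα : 0 < α) (hk : k₂ ∈ Set.Ioo (0 : ℝ) 1)
    (p q : ℕ) (hp : 0 < p) (hq : 0 < q) (hpq : Nat.Coprime p q)
    (hT : T = 2 * Real.pi * q) (hres : T = 4 * k₂ * Pendulum.ellK k₂ * p / √α) :
    -- the condition at first order
    (∀ (C₁ τ₀ : ℝ) (φbar Ibar : ℕ → ℝ) (φ I : ℕ → ℝ → ℝ),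
      Pendulum.IsFormalSolution α k₂ C₁ τ₀ φbar Ibar φ I →
      (Pendulum.avg T (Pendulum.F₂ α C₁ τ₀ φ I 1) = 0 ↔
        C₁ = k₂ * Real.sin τ₀ / (√α * Pendulum.Delta α k₂) * Pendulum.G₁ α k₂ T)) ∧
    -- the resonances `p / q = 1 / (2 * m)`
    ((∃ m : ℕ, 1 ≤ m ∧ (p : ℚ) / q = 1 / (2 * m)) →
      0 < k₂ / (√α * Pendulum.Delta α k₂) * Pendulum.G₁ α k₂ T ∧
      ∀ C₁ : ℝ, |C₁| < k₂ / (√α * Pendulum.Delta α k₂) * Pendulum.G₁ α k₂ T →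
        (∃ τ₀ : ℝ,
          C₁ = k₂ * Real.sin τ₀ / (√α * Pendulum.Delta α k₂) * Pendulum.G₁ α k₂ T) ∧
        ∀ τ₀ : ℝ,
          C₁ = k₂ * Real.sin τ₀ / (√α * Pendulum.Delta α k₂) * Pendulum.G₁ α k₂ T →
          ∃ (φbar Ibar : ℕ → ℝ) (φ I : ℕ → ℝ → ℝ),
            Pendulum.IsFormalSolution α k₂ C₁ τ₀ φbar Ibar φ I ∧
            ∀ n : ℕ, 1 ≤ n →
              Function.Periodic (φ n) T ∧ Function.Periodic (I n) T ∧
              Continuous (Pendulum.F₂ α C₁ τ₀ φ I n) ∧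
              Function.Periodic (Pendulum.F₂ α C₁ τ₀ φ I n) T ∧
              Pendulum.avg T (Pendulum.F₂ α C₁ τ₀ φ I n) = 0) ∧
    -- the other resonances
    ((∀ m : ℕ, 1 ≤ m → (p : ℚ) / q ≠ 1 / (2 * m)) →
      ∀ (C₁ τ₀ : ℝ) (φbar Ibar : ℕ → ℝ) (φ I : ℕ → ℝ → ℝ),
        Pendulum.IsFormalSolution α k₂ C₁ τ₀ φbar Ibar φ I →
        Pendulum.avg T (Pendulum.F₂ α C₁ τ₀ φ I 1) = 0 → C₁ = 0) := by
  have mk : Pendulum.Resonance α k₂ T p q := ⟨hα, hk, hp, hq, hT, hres⟩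
  have hratio (m : ℕ) (hm : 1 ≤ m) : (p : ℚ) / q = 1 / (2 * m) ↔ q = 2 * m * p := by
    rw [div_eq_div_iff (by positivity) (by positivity)]
    constructor
    · intro h
      have : p * (2 * m) = 1 * q := by exact_mod_cast h
      linarith
    · rintro rfl
      push_cast
      ring
  refine ⟨fun C₁ τ₀ φbar Ibar φ I h => mk.avg_F₂_one_eq_zero_iff h, ?_, ?_⟩
  · rintro ⟨m, hm, hpm⟩
    have hqm := (hratio m hm).1 hpm
    -- From q = 2mp, p divides q, and coprimality leaves only p = 1, the case covered by `G₁_pos`.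
    have hp1 : p = 1 := by
      have : p ∣ q := ⟨2 * m, by rw [hqm, mul_comm]⟩
      exact Nat.eq_one_of_dvd_coprimes hpq dvd_rfl this
    subst hp1
    rw [mul_one] at hqm
    subst hqm
    have hG := mk.G₁_pos
    have hΔ := mk.Delta_pos
    have hs := mk.sqrt_pos
    have hk0 := mk.k_pos
    have hB : 0 < k₂ / (√α * Pendulum.Delta α k₂) * Pendulum.G₁ α k₂ T := by positivity
    have hsin (τ₀ : ℝ) : k₂ * Real.sin τ₀ / (√α * Pendulum.Delta α k₂) * Pendulum.G₁ α k₂ T =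
        Real.sin τ₀ * (k₂ / (√α * Pendulum.Delta α k₂) * Pendulum.G₁ α k₂ T) := by ring
    refine ⟨hB, fun C₁ hC₁ => ⟨?_, fun τ₀ hC => ?_⟩⟩
    · set B := k₂ / (√α * Pendulum.Delta α k₂) * Pendulum.G₁ α k₂ T
      have hC := abs_lt.1 hC₁
      refine ⟨Real.arcsin (C₁ / B), ?_⟩
      rw [hsin, Real.sin_arcsin, div_mul_cancel₀ _ hB.ne']
      · rw [le_div_iff₀ hB]; linarith [hC.1]
      · rw [div_le_one hB]; exact hC.2.le
    -- If cos τ₀ were zero, then |sin τ₀| = 1 and |C₁| would equal the threshold, against the strict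
    -- inequality.
    · refine mk.exists_periodic hC (fun hcos => ?_) hG.ne'
      have h1 : |Real.sin τ₀| = 1 := by
        rw [← sq_eq_sq₀ (abs_nonneg _) zero_le_one, sq_abs, Real.sin_sq, hcos]; norm_num
      rw [hC, hsin, abs_mul, h1, one_mul, abs_of_pos hB] at hC₁
      exact lt_irrefl _ hC₁
  · intro hne C₁ τ₀ φbar Ibar φ I h havg
    rw [mk.avg_F₂_one_eq_zero_iff h] at havg
    by_cases hG : Pendulum.G₁ α k₂ T = 0
    · rw [havg, hG, mul_zero]
    · obtain ⟨m, hm, hqm⟩ := mk.exists_eq_of_G₁_ne_zero hG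
      exact absurd ((hratio m hm).2 hqm) (hne m hm)
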